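/- Let $I\subset\mathbb R$ be an open interval and $\alpha>0$. A function $f:I\to\mathbb R$ is called *$\mathrm{MC}_\alpha$ integrable on $I$* if there are $F:I\to\mathbb R$ (an indefinite $\mathrm{MC}_\alpha$ integral of $f$) and a strictly increasing $\varphi:I\to\mathbb R$ such that for every $x\in I$ $$\lim_{y\to x}\frac{F(y)-F(x)-f(x)(y-x)}{\varphi(x+\alpha(y-x))-\varphi(x)}=0 .$$ A function $F$ is *absolutely continuous* (AC) on a set $E\subset\mathbb R$ if for every $\varepsilon>0$ there is $\delta>0$ such that $\sum_i|F(b_i)-F(a_i)|<\varepsilon$ for every finite family of non-overlapping intervals $[a_i,b_i]$ with end-points in $E$ and $\sum_i(b_i-a_i)<\delta$; it is *ACG* on $E$ if it is continuous on $E$ and $E$ is a union of countably many sets on each of which $F$ is AC. A function $f$ is *Denjoy–Khintchine integrable* on an interval $J$ if there is a function $F$ that is ACG on $J$ and whose approximate derivative satisfies $F'_{\mathrm{ap}}(x)=f(x)$ for Lebesgue almost every $x\in J$; here $F'_{\mathrm{ap}}(x)=c$ means that $\frac{F(y)-F(x)}{y-x}\to c$ as $y\to x$ within some measurable set having $x$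 as a point of Lebesgue density. **Theorem.** There is a function $f:\mathbb R\to\mathbb R$ that is $\mathrm{MC}_\alpha$ integrable on $\mathbb R$ for every $\alpha>2$ but is not Denjoy–Khintchine integrable on $[0,1]$, nor on $(0,1)$. -/

import Mathlib

open Set Filter Topology MeasureTheory

/-- `F` is an indefinite `MC_α` (`α`-monotonically controlled) integral of `f` on the open
interval `I`: there is a strictly increasing control function `φ` on `I` such that, for each
`x ∈ I`, the quotient `(F y - F x - f x (y - x)) / (φ (x + α (y - x)) - φ x)` tends to `0` as
`y → x`, `y ≠ x`. As `I` is open, only values at points of `I` matter. -/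
def IsIndefiniteMCIntegral (α : ℝ) (F f : ℝ → ℝ) (I : Set ℝ) : Prop :=
  ∃ φ : ℝ → ℝ, StrictMonoOn φ I ∧ ∀ x ∈ I,
    Tendsto (fun y => (F y - F x - f x * (y - x)) / (φ (x + α * (y - x)) - φ x))
      (𝓝[≠] x) (𝓝 0)

/-- `f` is `MC_α` integrable on the open interval `I`: it has an indefinite `MC_α` integral. -/
def MCIntegrableOn (α : ℝ) (f : ℝ → ℝ) (I : Set ℝ) : Prop :=
  ∃ F : ℝ → ℝ, IsIndefiniteMCIntegral α F f I

/-- `F` is absolutely continuous (AC) on the set `E`: for every `ε > 0` there is `δ > 0` such that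
`∑ |F (b i) - F (a i)| < ε` for all finite families of non-overlapping intervals `[a i, b i]` with
end-points in `E` and total length less than `δ`. -/
def IsACOn (F : ℝ → ℝ) (E : Set ℝ) : Prop :=
  ∀ ε : ℝ, 0 < ε → ∃ δ : ℝ, 0 < δ ∧
    ∀ (n : ℕ) (a b : Fin n → ℝ),
      (∀ i, a i ∈ E) → (∀ i, b i ∈ E) → (∀ i, a i ≤ b i) →
      (∀ i j, i ≠ j → Disjoint (Ioo (a i) (b i)) (Ioo (a j) (b j))) →
      ∑ i, (b i - a i) < δ → ∑ i, |F (b i) - F (a i)| < ε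

/-- `F` is generalized absolutely continuous (ACG) on `E`: it is continuous on `E`, and `E` is the
union of countably many sets on each of which `F` is AC. -/
def IsACGOn (F : ℝ → ℝ) (E : Set ℝ) : Prop :=
  ContinuousOn F E ∧ ∃ S : ℕ → Set ℝ, E = ⋃ n, S n ∧ ∀ n, IsACOn F (S n)

/-- `x` is a point of density of `A` with respect to Lebesgue measure. -/
def IsDensityPoint (A : Set ℝ) (x : ℝ) : Prop :=
  Tendsto (fun h : ℝ => volume (A ∩ Icc (x - h) (x + h)) / ENNReal.ofReal (2 * h))
    (𝓝[>] 0) (𝓝 1)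

/-- `F` has the approximate derivative `c` at `x`: the difference quotient of `F` at `x` tends to
`c` along some measurable set having `x` as a point of density. -/
def HasApproxDerivAt (F : ℝ → ℝ) (c x : ℝ) : Prop :=
  ∃ A : Set ℝ, MeasurableSet A ∧ IsDensityPoint A x ∧
    Tendsto (fun y => (F y - F x) / (y - x)) (𝓝[A \ {x}] x) (𝓝 c)

/-- `F` is an indefinite Denjoy–Khintchine integral of `f` on the interval `I`: `F` is ACG on `I`
and its approximate derivative equals `f x` at almost every `x ∈ I`. (At interior points of `I`
the approximate derivative depends only on the values of `F` on `I`.) -/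
def IsIndefiniteDKIntegral (F f : ℝ → ℝ) (I : Set ℝ) : Prop :=
  IsACGOn F I ∧ ∀ᵐ x : ℝ, x ∈ I → HasApproxDerivAt F (f x) x

/-- `f` is Denjoy–Khintchine integrable on the interval `I`: it has an indefinite
Denjoy–Khintchine integral on `I`. -/
def DKIntegrableOn (f : ℝ → ℝ) (I : Set ℝ) : Prop :=
  ∃ F : ℝ → ℝ, IsIndefiniteDKIntegral F f I

/-! The indefinite integral is a signed analogue of the Cantor function: `F = oscillatingCantor`
increases by `T j = (-1/2)^j/(j+1)` on every interval of order `j` of the Cantor construction, and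
by `T j - 2 * T (j+1)` across the gap of such an interval. The integrand is `F'` off the Cantor set
and `0` on it.

Integrability. All the change on a gap of order `j` happens in a ramp around its midpoint, whose
relative width tends to `0`. Let `x` be a Cantor point and `y > x`. At the first scale where `y`
reaches a ramp to the right of `x`, the point `x + α(y-x)` lies definitely beyond the gap, since `α
> 2` and the ramp is thin. There the Cantor function has grown by a fixed fraction of `2^{-j}`,
while `F` has changed by only `O(2^{-j}/(j+1))`. So the Cantor function controls `F` on the Cantor
set. The identity controls it at points of differentiability, and a jump function at the countably
many ramp corners. The control function is the sum of the three (`eventually_abs_cantorLim_sub_le`,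
`isIndefiniteMCIntegral_oscillatingCantor`).

Non-integrability. A Denjoy–Khintchine integral `H` differs from `F` by a constant on each gap,
because an ACG function with approximate derivative zero almost everywhere is constant
(`eq_of_hasApproxDerivAt_zero`). Signs alternate, so the `2^j` gaps of order `j` together contribute
at least `1/(j+1)` to the variation of `H`. By self-similarity and divergence of the harmonic
series, `H` has infinite variation on every portion of the Cantor set. By Baire, one of the sets on
which `H` is AC is dense in some portion, and continuity then makes the variation finite on a small
portion (`FollowsGapsOn.false_of_isACOn`). -/

/-! ### Ramps inside the middle third. -/

/-- The continuous piecewise linear transition from `0` to `1`, with slope `6 * (n + 1)`, centred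
at `1 / 2`. -/
noncomputable def ramp (n : ℕ) (x : ℝ) : ℝ := max 0 (min 1 ((x - 1 / 2) * (6 * (n + 1)) + 1 / 2))

theorem ramp_nonneg (n : ℕ) (x : ℝ) : 0 ≤ ramp n x := le_max_left _ _

theorem ramp_le_one (n : ℕ) (x : ℝ) : ramp n x ≤ 1 := max_le zero_le_one (min_le_left _ _)

theorem ramp_eq_zero {n : ℕ} {x : ℝ} (h : x ≤ 1 / 2 - 1 / (12 * (n + 1))) : ramp n x = 0 := by
  have hn : (0 : ℝ) < n + 1 := by positivity
  refine max_eq_left ((min_le_right _ _).trans ?_)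
  have : (x - 1 / 2) * (6 * (n + 1)) ≤ -(1 / (12 * (n + 1))) * (6 * (n + 1)) :=
    mul_le_mul_of_nonneg_right (by linarith) (by positivity)
  have h2 : -(1 / (12 * ((n : ℝ) + 1))) * (6 * (n + 1)) = -(1 / 2) := by
    field_simp; norm_num
  linarith

theorem ramp_eq_one {n : ℕ} {x : ℝ} (h : 1 / 2 + 1 / (12 * (n + 1)) ≤ x) : ramp n x = 1 := by
  have hn : (0 : ℝ) < n + 1 := by positivity
  have : (1 / (12 * (n + 1))) * (6 * (n + 1)) ≤ (x - 1 / 2) * (6 * (n + 1)) :=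
    mul_le_mul_of_nonneg_right (by linarith) (by positivity)
  have h2 : (1 / (12 * ((n : ℝ) + 1))) * (6 * (n + 1)) = 1 / 2 := by
    field_simp; norm_num
  rw [ramp, min_eq_left (by linarith), max_eq_right zero_le_one]

/-- Keeps every ramp inside `[5/12, 7/12]`, well within the gap `(1/3, 2/3)`. -/
theorem ramp_halfwidth_le (n : ℕ) : 1 / (12 * ((n : ℝ) + 1)) ≤ 1 / 12 := by
  apply one_div_le_one_div_of_le (by norm_num)
  have : (0 : ℝ) ≤ n := n.cast_nonneg
  linarith

theorem ramp_eq_zero' {n : ℕ} {x : ℝ} (h : x ≤ 5 / 12) : ramp n x = 0 :=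
  ramp_eq_zero (by linarith [ramp_halfwidth_le n])

theorem ramp_eq_one' {n : ℕ} {x : ℝ} (h : 7 / 12 ≤ x) : ramp n x = 1 :=
  ramp_eq_one (by linarith [ramp_halfwidth_le n])

theorem ramp_one_sub (n : ℕ) (x : ℝ) : ramp n (1 - x) = 1 - ramp n x := by
  have e : (1 - x - 1 / 2) * (6 * ((n : ℝ) + 1)) + 1 / 2
      = 1 - ((x - 1 / 2) * (6 * (n + 1)) + 1 / 2) := by ring
  rw [ramp, ramp, e]
  generalize (x - 1 / 2) * (6 * ((n : ℝ) + 1)) + 1 / 2 = t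
  rcases le_total t 0 with h | h
  · rw [min_eq_left (by linarith), min_eq_right (by linarith), max_eq_left h,
      max_eq_right zero_le_one]; ring
  · rcases le_total t 1 with h' | h'
    · rw [min_eq_right (by linarith), min_eq_right h', max_eq_right h, max_eq_right (by linarith)]
    · rw [min_eq_right (by linarith), min_eq_left h', max_eq_left (by linarith),
        max_eq_right zero_le_one]; ring

theorem ramp_monotone (n : ℕ) : Monotone (ramp n) := by
  intro x y h
  have : (x - 1 / 2) * (6 * ((n : ℝ) + 1)) ≤ (y - 1 / 2) * (6 * (n + 1)) :=
    mul_le_mul_of_nonneg_right (by linarith) (by positivity)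
  exact max_le_max le_rfl (min_le_min le_rfl (by linarith))

/-! ### Self-similar functions on the Cantor construction. -/

/-- `T n` is bounded by `e n / 2 ^ n` for an antitone sequence `e`. -/
structure IsDyadicBound (T e : ℕ → ℝ) : Prop where
  anti : Antitone e
  bound : ∀ n, |T n| ≤ e n * (1 / 2) ^ n

namespace IsDyadicBound

variable {T e : ℕ → ℝ}

theorem nonneg (h : IsDyadicBound T e) (n : ℕ) : 0 ≤ e n := by
  have := (abs_nonneg _).trans (h.bound n)
  by_contra! h'
  have := mul_neg_of_neg_of_pos h' (show (0 : ℝ) < (1 / 2) ^ n by positivity)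
  linarith

theorem step (h : IsDyadicBound T e) (n k : ℕ) :
    e (n + 1) * (1 / 2) ^ (n + 1 + k) ≤ e n * (1 / 2) ^ (n + k) / 2 := by
  have h1 : e (n + 1) * (1 / 2) ^ (n + 1 + k) ≤ e n * (1 / 2) ^ (n + 1 + k) :=
    mul_le_mul_of_nonneg_right (h.anti n.le_succ) (by positivity)
  refine h1.trans (le_of_eq ?_)
  rw [show n + 1 + k = (n + k) + 1 by ring, pow_succ]
  ring

end IsDyadicBound

/-- Approximants of `cantorLim T n`: continuous functions which increase by `T (n + j)` on each of
the `2 ^ j` intervals of order `j ≤ k` of the construction of the Cantor set. -/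
noncomputable def cantorApprox (T : ℕ → ℝ) : ℕ → ℕ → ℝ → ℝ
  | 0, n, x => T n * ramp n x
  | k + 1, n, x => cantorApprox T k (n + 1) (3 * x) + cantorApprox T k (n + 1) (3 * x - 2) +
      (T n - 2 * T (n + 1)) * ramp n x

theorem cantorApprox_succ (T : ℕ → ℝ) (k n : ℕ) (x : ℝ) : cantorApprox T (k + 1) n x =
    cantorApprox T k (n + 1) (3 * x) + cantorApprox T k (n + 1) (3 * x - 2) +
      (T n - 2 * T (n + 1)) * ramp n x := rfl

theorem cantorApprox_of_nonpos (T : ℕ → ℝ) (k n : ℕ) {x : ℝ} (h : x ≤ 0) :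
    cantorApprox T k n x = 0 := by
  induction k generalizing n x with
  | zero => simp [cantorApprox, ramp_eq_zero' (n := n) (show x ≤ 5 / 12 by linarith)]
  | succ k ih =>
    rw [cantorApprox, ih _ (by linarith), ih _ (by linarith),
      ramp_eq_zero' (n := n) (show x ≤ 5 / 12 by linarith)]
    ring

theorem cantorApprox_of_one_le (T : ℕ → ℝ) (k n : ℕ) {x : ℝ} (h : 1 ≤ x) :
    cantorApprox T k n x = T n := by
  induction k generalizing n x with
  | zero => simp [cantorApprox, ramp_eq_one' (n := n) (show 7 / 12 ≤ x by linarith)]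
  | succ k ih =>
    rw [cantorApprox, ih _ (by linarith), ih _ (by linarith),
      ramp_eq_one' (n := n) (show 7 / 12 ≤ x by linarith)]
    ring

theorem cantorApprox_one_sub (T : ℕ → ℝ) (k n : ℕ) (x : ℝ) :
    cantorApprox T k n (1 - x) = T n - cantorApprox T k n x := by
  induction k generalizing n x with
  | zero => simp only [cantorApprox, ramp_one_sub]; ring
  | succ k ih =>
    rw [cantorApprox, cantorApprox, ramp_one_sub, show 3 * (1 - x) = 1 - (3 * x - 2) by ring,
      show 1 - (3 * x - 2) - 2 = 1 - 3 * x by ring, ih, ih]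
    ring

/-- The constant `3` reproduces itself: on the right third the value is `T n - T (n + 1)` plus a
value of the next copy, and `1 + 1/2 + 3/2 = 3` in units of `e n * (1 / 2) ^ n`. -/
theorem abs_cantorApprox_le {T e : ℕ → ℝ} (h : IsDyadicBound T e) (k n : ℕ) (x : ℝ) :
    |cantorApprox T k n x| ≤ 3 * (e n * (1 / 2) ^ n) := by
  have h0 := h.bound n
  have r0 := ramp_nonneg n x
  have r1 := ramp_le_one n x
  induction k generalizing n x with
  | zero =>
    rw [cantorApprox, abs_mul, abs_of_nonneg r0]
    nlinarith [abs_nonneg (T n)]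
  | succ k ih =>
    have h1 := h.bound (n + 1)
    have hs := h.step n 0
    rw [add_zero, add_zero] at hs
    have ih' : ∀ y, |cantorApprox T k (n + 1) y| ≤ 3 * (e (n + 1) * (1 / 2) ^ (n + 1)) := fun y ↦
      ih (n + 1) y h1 (ramp_nonneg _ _) (ramp_le_one _ _)
    rw [cantorApprox]
    rcases le_or_gt x (1 / 3) with hx | hx
    · rw [cantorApprox_of_nonpos T k _ (show 3 * x - 2 ≤ 0 by linarith),
        ramp_eq_zero' (n := n) (show x ≤ 5 / 12 by linarith), add_zero, mul_zero, add_zero]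
      linarith [ih' (3 * x), h.nonneg n, (abs_nonneg _).trans h0]
    · rw [cantorApprox_of_one_le T k _ (show 1 ≤ 3 * x by linarith)]
      rw [abs_le] at h0 h1 ⊢
      rcases le_or_gt (2 / 3) x with hx' | hx'
      · rw [ramp_eq_one' (n := n) (show 7 / 12 ≤ x by linarith)]
        have := abs_le.1 (ih' (3 * x - 2))
        constructor <;> linarith
      · rw [cantorApprox_of_nonpos T k _ (show 3 * x - 2 ≤ 0 by linarith)]
        constructor <;> nlinarith

/-- The ramp terms cancel, and at each point one of the two copies is constant with a value
independent of `k`. Hence the difference is inherited from a single copy of order `n + 1`, where the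
bound has halved. -/
theorem abs_cantorApprox_succ_sub_le {T e : ℕ → ℝ} (h : IsDyadicBound T e) (k n : ℕ) (x : ℝ) :
    |cantorApprox T (k + 1) n x - cantorApprox T k n x| ≤ 6 * (e n * (1 / 2) ^ (n + k)) := by
  induction k generalizing n x with
  | zero =>
    refine (abs_sub _ _).trans ?_
    rw [add_zero]
    linarith [abs_cantorApprox_le h (0 + 1) n x, abs_cantorApprox_le h 0 n x]
  | succ k ih =>
    have hs := h.step n k
    rw [cantorApprox_succ T (k + 1) n, cantorApprox_succ T k n]
    have h0 : 0 ≤ e n * (1 / 2) ^ (n + k) := mul_nonneg (h.nonneg n) (by positivity)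
    have e1 : e n * (1 / 2) ^ (n + (k + 1)) = e n * (1 / 2) ^ (n + k) / 2 := by
      rw [← add_assoc, pow_succ]; ring
    rw [e1]
    rcases le_or_gt x (1 / 3) with hx | hx
    · have := ih (n + 1) (3 * x)
      rw [cantorApprox_of_nonpos T (k + 1) _ (show 3 * x - 2 ≤ 0 by linarith),
        cantorApprox_of_nonpos T k _ (show 3 * x - 2 ≤ 0 by linarith)]
      rw [abs_le] at this ⊢
      constructor <;> linarith
    · have := ih (n + 1) (3 * x - 2)
      rw [cantorApprox_of_one_le T (k + 1) _ (show 1 ≤ 3 * x by linarith),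
        cantorApprox_of_one_le T k _ (show 1 ≤ 3 * x by linarith)]
      rw [abs_le] at this ⊢
      constructor <;> linarith

/-- The self-similar function which increases by `T (n + j)` on each interval of order `j` of the
construction of the Cantor set. -/
noncomputable def cantorLim (T : ℕ → ℝ) (n : ℕ) (x : ℝ) : ℝ :=
  limUnder atTop fun k ↦ cantorApprox T k n x

section cantorLim

variable {T e : ℕ → ℝ}

theorem tendsto_cantorApprox (h : IsDyadicBound T e) (n : ℕ) (x : ℝ) :
    Tendsto (fun k ↦ cantorApprox T k n x) atTop (𝓝 (cantorLim T n x)) := by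
  refine CauchySeq.tendsto_limUnder (cauchySeq_of_le_geometric (1 / 2) (6 * (e n * (1 / 2) ^ n))
    (by norm_num) fun k ↦ ?_)
  rw [dist_comm, Real.dist_eq]
  refine (abs_cantorApprox_succ_sub_le h k n x).trans (le_of_eq ?_)
  ring

theorem cantorLim_eq (h : IsDyadicBound T e) (n : ℕ) (x : ℝ) :
    cantorLim T n x = cantorLim T (n + 1) (3 * x) + cantorLim T (n + 1) (3 * x - 2) +
      (T n - 2 * T (n + 1)) * ramp n x := by
  refine tendsto_nhds_unique ((tendsto_add_atTop_iff_nat 1).2 (tendsto_cantorApprox h n x)) ?_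
  exact ((tendsto_cantorApprox h _ _).add (tendsto_cantorApprox h _ _)).add_const _

theorem cantorLim_of_nonpos (h : IsDyadicBound T e) (n : ℕ) {x : ℝ} (hx : x ≤ 0) :
    cantorLim T n x = 0 :=
  tendsto_nhds_unique (tendsto_cantorApprox h n x)
    (by simp only [cantorApprox_of_nonpos T _ n hx]; exact tendsto_const_nhds)

theorem cantorLim_of_one_le (h : IsDyadicBound T e) (n : ℕ) {x : ℝ} (hx : 1 ≤ x) :
    cantorLim T n x = T n :=
  tendsto_nhds_unique (tendsto_cantorApprox h n x)
    (by simp only [cantorApprox_of_one_le T _ n hx]; exact tendsto_const_nhds)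

theorem cantorLim_one_sub (h : IsDyadicBound T e) (n : ℕ) (x : ℝ) :
    cantorLim T n (1 - x) = T n - cantorLim T n x :=
  tendsto_nhds_unique (tendsto_cantorApprox h n (1 - x))
    (by simp only [cantorApprox_one_sub]; exact (tendsto_cantorApprox h n x).const_sub _)

theorem abs_cantorLim_le (h : IsDyadicBound T e) (n : ℕ) (x : ℝ) :
    |cantorLim T n x| ≤ 3 * (e n * (1 / 2) ^ n) :=
  le_of_tendsto' (tendsto_cantorApprox h n x).abs fun k ↦ abs_cantorApprox_le h k n x

theorem abs_cantorLim_sub_le (h : IsDyadicBound T e) (n : ℕ) (x y : ℝ) :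
    |cantorLim T n x - cantorLim T n y| ≤ 6 * (e n * (1 / 2) ^ n) :=
  (abs_sub _ _).trans (by linarith [abs_cantorLim_le h n x, abs_cantorLim_le h n y])

/-- On the left part the function is a copy of the next one. -/
theorem cantorLim_left (h : IsDyadicBound T e) (n : ℕ) {x : ℝ}
    (hx : x ≤ 1 / 2 - 1 / (12 * (n + 1))) : cantorLim T n x = cantorLim T (n + 1) (3 * x) := by
  have : (0 : ℝ) < 1 / (12 * (n + 1)) := by positivity
  rw [cantorLim_eq h, ramp_eq_zero hx, cantorLim_of_nonpos h _ (show 3 * x - 2 ≤ 0 by linarith)]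
  ring

/-- On the right part the function is a translated copy of the next one. -/
theorem cantorLim_right (h : IsDyadicBound T e) (n : ℕ) {x : ℝ}
    (hx : 1 / 2 + 1 / (12 * (n + 1)) ≤ x) :
    cantorLim T n x = cantorLim T (n + 1) (3 * x - 2) + (T n - T (n + 1)) := by
  have : (0 : ℝ) < 1 / (12 * (n + 1)) := by positivity
  rw [cantorLim_eq h, ramp_eq_one hx, cantorLim_of_one_le h _ (show 1 ≤ 3 * x by linarith)]
  ring

theorem cantorLim_left' (h : IsDyadicBound T e) (n : ℕ) {x : ℝ} (hx : x ≤ 1 / 3) :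
    cantorLim T n x = cantorLim T (n + 1) (3 * x) :=
  cantorLim_left h n (by linarith [ramp_halfwidth_le n])

theorem cantorLim_right' (h : IsDyadicBound T e) (n : ℕ) {x : ℝ} (hx : 2 / 3 ≤ x) :
    cantorLim T n x = cantorLim T (n + 1) (3 * x - 2) + (T n - T (n + 1)) :=
  cantorLim_right h n (by linarith [ramp_halfwidth_le n])

end cantorLim

/-! ### Self-similarity and symmetry of the Cantor set. -/

theorem cantorSet_cases {x : ℝ} (hx : x ∈ cantorSet) :
    (0 ≤ x ∧ x ≤ 1 / 3 ∧ 3 * x ∈ cantorSet) ∨ (2 / 3 ≤ x ∧ x ≤ 1 ∧ 3 * x - 2 ∈ cantorSet) := by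
  rw [cantorSet_eq_union_halves] at hx
  rcases hx with ⟨y, hy, rfl⟩ | ⟨y, hy, rfl⟩ <;> have := cantorSet_subset_unitInterval hy
  · refine Or.inl ⟨?_, ?_, ?_⟩ <;> dsimp only
    · linarith [this.1]
    · linarith [this.2]
    · rwa [mul_div_cancel₀ _ (by norm_num)]
  · refine Or.inr ⟨?_, ?_, ?_⟩ <;> dsimp only
    · linarith [this.1]
    · linarith [this.2]
    · rwa [mul_div_cancel₀ _ (by norm_num), add_sub_cancel_left]

theorem mem_cantorSet_of_three_mul {x : ℝ} (hx : 3 * x ∈ cantorSet) : x ∈ cantorSet := by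
  rw [cantorSet_eq_union_halves]
  exact Or.inl ⟨_, hx, by dsimp only; ring⟩

theorem mem_cantorSet_of_three_mul_sub {x : ℝ} (hx : 3 * x - 2 ∈ cantorSet) : x ∈ cantorSet := by
  rw [cantorSet_eq_union_halves]
  exact Or.inr ⟨_, hx, by dsimp only; ring⟩

theorem one_sub_mem_preCantorSet {n : ℕ} {x : ℝ} (hx : x ∈ preCantorSet n) :
    1 - x ∈ preCantorSet n := by
  induction n generalizing x with
  | zero => exact ⟨by linarith [hx.2], by linarith [hx.1]⟩
  | succ n ih =>
    rcases hx with ⟨y, hy, rfl⟩ | ⟨y, hy, rfl⟩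
    · exact Or.inr ⟨_, ih hy, by dsimp only; ring⟩
    · exact Or.inl ⟨_, ih hy, by dsimp only; ring⟩

theorem one_sub_mem_cantorSet {x : ℝ} (hx : x ∈ cantorSet) : 1 - x ∈ cantorSet :=
  mem_iInter.2 fun n ↦ one_sub_mem_preCantorSet (mem_iInter.1 hx n)

theorem one_mem_cantorSet : (1 : ℝ) ∈ cantorSet := by
  simpa using one_sub_mem_cantorSet zero_mem_cantorSet

/-! ### Regularity of the limit functions off the Cantor set. -/

theorem lipschitzWith_ramp (n : ℕ) : LipschitzWith (6 * (n + 1)) (ramp n) := by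
  refine LipschitzWith.const_max (LipschitzWith.const_min ?_ 1) 0
  refine LipschitzWith.of_dist_le_mul fun x y ↦ le_of_eq ?_
  rw [Real.dist_eq, Real.dist_eq]
  push_cast
  rw [← abs_of_pos (show (0 : ℝ) < 6 * (n + 1) by positivity), ← abs_mul,
    abs_of_pos (show (0 : ℝ) < 6 * (n + 1) by positivity)]
  congr 1
  ring

theorem differentiableAt_ramp {n : ℕ} {x : ℝ} (h1 : x ≠ 1 / 2 - 1 / (12 * (n + 1)))
    (h2 : x ≠ 1 / 2 + 1 / (12 * (n + 1))) : DifferentiableAt ℝ (ramp n) x := by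
  have hn : (0 : ℝ) < n + 1 := by positivity
  rcases lt_or_gt_of_ne h1 with h | h
  · refine (differentiableAt_const (0 : ℝ)).congr_of_eventuallyEq ?_
    filter_upwards [Iio_mem_nhds h] with y hy using ramp_eq_zero (le_of_lt hy)
  rcases lt_or_gt_of_ne h2 with h' | h'
  · have : DifferentiableAt ℝ (fun x : ℝ ↦ (x - 1 / 2) * (6 * ((n : ℝ) + 1)) + 1 / 2) x := by
      fun_prop
    refine this.congr_of_eventuallyEq ?_
    filter_upwards [Ioo_mem_nhds h h'] with y hy
    have e : (1 / (12 * ((n : ℝ) + 1))) * (6 * (n + 1)) = 1 / 2 := by field_simp; norm_num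
    have a := mul_le_mul_of_nonneg_right (show -(1 / (12 * ((n : ℝ) + 1))) ≤ y - 1 / 2 by
      linarith [hy.1]) (show 0 ≤ 6 * ((n : ℝ) + 1) by positivity)
    have b := mul_le_mul_of_nonneg_right (show y - 1 / 2 ≤ 1 / (12 * ((n : ℝ) + 1)) by
      linarith [hy.2]) (show 0 ≤ 6 * ((n : ℝ) + 1) by positivity)
    rw [ramp, min_eq_right (by linarith), max_eq_right (by linarith)]
  · refine (differentiableAt_const (1 : ℝ)).congr_of_eventuallyEq ?_
    filter_upwards [Ioi_mem_nhds h'] with y hy using ramp_eq_one (le_of_lt hy)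

theorem continuous_cantorApprox (T : ℕ → ℝ) (k n : ℕ) : Continuous (cantorApprox T k n) := by
  have hr : ∀ n, Continuous (ramp n) := fun n ↦ (lipschitzWith_ramp n).continuous
  induction k generalizing n with
  | zero => exact (hr n).const_mul _
  | succ k ih =>
    exact (((ih _).comp (by fun_prop)).add ((ih _).comp (by fun_prop))).add ((hr n).const_mul _)

section

variable {T e : ℕ → ℝ}

theorem continuous_cantorLim (h : IsDyadicBound T e) (n : ℕ) : Continuous (cantorLim T n) := by
  have hu : TendstoUniformly (fun k ↦ cantorApprox T k n) (cantorLim T n) atTop := by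
    rw [Metric.tendstoUniformly_iff]
    intro ε hε
    have h0 : Tendsto (fun k : ℕ ↦ 6 * (e n * (1 / 2) ^ n) * (1 / 2 : ℝ) ^ k / (1 - 1 / 2)) atTop
        (𝓝 (6 * (e n * (1 / 2) ^ n) * 0 / (1 - 1 / 2))) :=
      ((tendsto_pow_atTop_nhds_zero_of_lt_one (by norm_num) (by norm_num)).const_mul _).div_const _
    rw [mul_zero, zero_div] at h0
    filter_upwards [h0.eventually_lt_const hε] with k hk x
    rw [dist_comm]
    refine (dist_le_of_le_geometric_of_tendsto (1 / 2) (6 * (e n * (1 / 2) ^ n)) (by norm_num)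
      (fun k ↦ ?_) (tendsto_cantorApprox h n x) k).trans_lt hk
    rw [dist_comm, Real.dist_eq]
    refine (abs_cantorApprox_succ_sub_le h k n x).trans (le_of_eq ?_)
    ring
  exact hu.continuous (Eventually.of_forall fun k ↦ continuous_cantorApprox T k n).frequently

theorem three_mul_notMem_preCantorSet {k : ℕ} {x : ℝ} (hx : x ∉ preCantorSet (k + 1)) :
    3 * x ∉ preCantorSet k :=
  fun h ↦ hx (Or.inl ⟨_, h, by dsimp only; ring⟩)

theorem three_mul_sub_notMem_preCantorSet {k : ℕ} {x : ℝ} (hx : x ∉ preCantorSet (k + 1)) :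
    3 * x - 2 ∉ preCantorSet k :=
  fun h ↦ hx (Or.inr ⟨_, h, by dsimp only; ring⟩)

theorem cantorLim_eventuallyEq_const (h : IsDyadicBound T e) (n : ℕ) {x : ℝ}
    (hx : x ∉ Icc (0 : ℝ) 1) : ∃ C : ℝ, cantorLim T n =ᶠ[𝓝 x] fun _ ↦ C := by
  rcases lt_or_ge x 0 with h0 | h0
  · refine ⟨0, ?_⟩
    filter_upwards [Iio_mem_nhds h0] with y hy using cantorLim_of_nonpos h n (le_of_lt hy)
  · have h1 : 1 < x := by
      by_contra! h1
      exact hx ⟨h0, h1⟩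
    refine ⟨T n, ?_⟩
    filter_upwards [Ioi_mem_nhds h1] with y hy using cantorLim_of_one_le h n (le_of_lt hy)

/-- Off `preCantorSet k`, unfolding the functional equation `k` times leaves finitely many ramps
plus copies evaluated outside `[0, 1]`, which are locally constant. -/
theorem cantorLim_lipschitzOn_nhds (h : IsDyadicBound T e) (k n : ℕ) {x : ℝ}
    (hx : x ∉ preCantorSet k) : ∃ K, ∃ t ∈ 𝓝 x, LipschitzOnWith K (cantorLim T n) t := by
  induction k generalizing n x with
  | zero =>
    obtain ⟨C, hC⟩ := cantorLim_eventuallyEq_const h n hx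
    refine ⟨0, _, hC, ?_⟩
    intro y hy z hz
    rw [mem_ofPred_eq] at hy hz
    simp [hy, hz]
  | succ k ih =>
    obtain ⟨K1, t1, ht1, hl1⟩ := ih (n + 1) (three_mul_notMem_preCantorSet hx)
    obtain ⟨K2, t2, ht2, hl2⟩ := ih (n + 1) (three_mul_sub_notMem_preCantorSet hx)
    have a1 : LipschitzWith 3 fun y : ℝ ↦ 3 * y :=
      LipschitzWith.of_dist_le_mul fun y z ↦ by
        simp [Real.dist_eq, ← mul_sub, abs_mul]
    have a2 : LipschitzWith 3 fun y : ℝ ↦ 3 * y - 2 :=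
      LipschitzWith.of_dist_le_mul fun y z ↦ by
        simp [Real.dist_eq, ← mul_sub, abs_mul]
    have m1 : (fun y : ℝ ↦ 3 * y) ⁻¹' t1 ∈ 𝓝 x := a1.continuous.continuousAt ht1
    have m2 : (fun y : ℝ ↦ 3 * y - 2) ⁻¹' t2 ∈ 𝓝 x := a2.continuous.continuousAt ht2
    have a3 : LipschitzWith (‖T n - 2 * T (n + 1)‖₊ * (6 * (n + 1)))
        fun y ↦ (T n - 2 * T (n + 1)) * ramp n y :=
      (lipschitzWith_smul (T n - 2 * T (n + 1))).comp (lipschitzWith_ramp n)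
    refine ⟨K1 * 3 + K2 * 3 + ‖T n - 2 * T (n + 1)‖₊ * (6 * (n + 1)), _, inter_mem m1 m2, ?_⟩
    · rw [show cantorLim T n = fun y ↦ cantorLim T (n + 1) (3 * y) + cantorLim T (n + 1) (3 * y - 2)
        + (T n - 2 * T (n + 1)) * ramp n y from funext (cantorLim_eq h n)]
      refine LipschitzOnWith.add (LipschitzOnWith.add ?_ ?_) (a3.lipschitzOnWith)
      · exact hl1.comp a1.lipschitzOnWith fun y hy ↦ hy.1
      · exact hl2.comp a2.lipschitzOnWith fun y hy ↦ hy.2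

/-- Only the two corners of each ramp, pulled back through the unfolding, can be exceptional. -/
theorem countable_not_differentiableAt_cantorLim_aux (h : IsDyadicBound T e) (k n : ℕ) :
    {x | x ∉ preCantorSet k ∧ ¬ DifferentiableAt ℝ (cantorLim T n) x}.Countable := by
  induction k generalizing n with
  | zero =>
    convert countable_empty
    refine eq_empty_of_forall_notMem fun x hx ↦ hx.2 ?_
    obtain ⟨C, hC⟩ := cantorLim_eventuallyEq_const h n hx.1
    exact (differentiableAt_const C).congr_of_eventuallyEq hC
  | succ k ih =>
    have c1 := (ih (n + 1)).preimage (f := fun x : ℝ ↦ 3 * x) fun x y hxy ↦ by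
      simpa using hxy
    have c2 := (ih (n + 1)).preimage (f := fun x : ℝ ↦ 3 * x - 2) fun x y hxy ↦ by
      simpa using hxy
    refine ((c1.union c2).union (((countable_singleton (1 / 2 - 1 / (12 * ((n : ℝ) + 1)))).insert
      (1 / 2 + 1 / (12 * ((n : ℝ) + 1)))))).mono ?_
    rintro x ⟨hx, hd⟩
    by_contra hc
    simp only [mem_union, mem_preimage, mem_ofPred_eq, mem_insert_iff, mem_singleton_iff, not_or,
      not_and, not_not] at hc
    refine hd ?_
    rw [show cantorLim T n = fun y ↦ cantorLim T (n + 1) (3 * y) + cantorLim T (n + 1) (3 * y - 2)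
        + (T n - 2 * T (n + 1)) * ramp n y from funext (cantorLim_eq h n)]
    have d1 := hc.1.1 (three_mul_notMem_preCantorSet hx)
    have d2 := hc.1.2 (three_mul_sub_notMem_preCantorSet hx)
    have d3 := differentiableAt_ramp hc.2.2 hc.2.1
    exact ((d1.comp (f := fun y : ℝ ↦ 3 * y) x (by fun_prop)).add
      (d2.comp (f := fun y : ℝ ↦ 3 * y - 2) x (by fun_prop))).add (d3.const_mul _)

theorem countable_not_differentiableAt_cantorLim (h : IsDyadicBound T e) (n : ℕ) :
    {x | x ∉ cantorSet ∧ ¬ DifferentiableAt ℝ (cantorLim T n) x}.Countable := by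
  refine (countable_iUnion fun k ↦ countable_not_differentiableAt_cantorLim_aux h k n).mono ?_
  rintro x ⟨hx, hd⟩
  rw [cantorSet, mem_iInter, not_forall] at hx
  obtain ⟨k, hk⟩ := hx
  exact mem_iUnion.2 ⟨k, hk, hd⟩

end

/-! ### The Cantor function. -/

theorem isDyadicBound_half : IsDyadicBound (fun n ↦ (1 / 2 : ℝ) ^ n) fun _ ↦ 1 :=
  ⟨antitone_const, fun n ↦ by rw [one_mul, abs_of_nonneg (by positivity)]⟩

/-- Up to the factor `2 ^ n`, the Cantor function. -/
noncomputable def cantorFun : ℕ → ℝ → ℝ := cantorLim fun n ↦ (1 / 2 : ℝ) ^ n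

theorem monotone_cantorApprox_half (k n : ℕ) :
    Monotone (cantorApprox (fun n ↦ (1 / 2 : ℝ) ^ n) k n) := by
  induction k generalizing n with
  | zero => exact fun x y hxy ↦ mul_le_mul_of_nonneg_left (ramp_monotone n hxy) (by positivity)
  | succ k ih =>
    intro x y hxy
    have e0 : (1 / 2 : ℝ) ^ n - 2 * (1 / 2) ^ (n + 1) = 0 := by ring
    simp only [cantorApprox_succ, e0, zero_mul, add_zero]
    exact add_le_add (ih _ (by linarith)) (ih _ (by linarith))

theorem monotone_cantorFun (n : ℕ) : Monotone (cantorFun n) := fun x y hxy ↦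
  le_of_tendsto_of_tendsto' (tendsto_cantorApprox isDyadicBound_half n x)
    (tendsto_cantorApprox isDyadicBound_half n y) fun k ↦ monotone_cantorApprox_half k n hxy

theorem cantorFun_eq (n : ℕ) (x : ℝ) :
    cantorFun n x = cantorFun (n + 1) (3 * x) + cantorFun (n + 1) (3 * x - 2) := by
  have := cantorLim_eq isDyadicBound_half n x
  rw [show (1 / 2 : ℝ) ^ n - 2 * (1 / 2) ^ (n + 1) = 0 by ring, zero_mul, add_zero] at this
  exact this

theorem cantorFun_nonneg (n : ℕ) (x : ℝ) : 0 ≤ cantorFun n x := by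
  rcases le_total x 0 with h | h
  · exact (cantorLim_of_nonpos isDyadicBound_half n h).ge
  · exact (cantorLim_of_nonpos isDyadicBound_half n le_rfl).ge.trans (monotone_cantorFun n h)

/-- By the time `x` reaches `3^{-k}`, a whole interval of order `k` has been crossed. -/
theorem le_cantorFun {k : ℕ} (n : ℕ) {x : ℝ} (h : 1 ≤ 3 ^ k * x) :
    (1 / 2) ^ (n + k) ≤ cantorFun n x := by
  induction k generalizing n x with
  | zero => exact (cantorLim_of_one_le isDyadicBound_half n (by simpa using h)).ge
  | succ k ih =>
    have := ih (n + 1) (x := 3 * x) (by rw [← mul_assoc, ← pow_succ]; exact h)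
    rw [cantorFun_eq]
    rw [show n + (k + 1) = n + 1 + k by ring]
    linarith [cantorFun_nonneg (n + 1) (3 * x - 2)]

/-! ### Control of the increments at Cantor points when `α > 2`. -/

section

variable {T e : ℕ → ℝ} {α : ℝ} {n₀ k₀ : ℕ}

/-- The excess `(α - 2) / 12` beyond `2/3` becomes `(α - 2) / 4 ≥ 3^{-k₀}` in the coordinates of the
right third, so it contains a full interval of order `k₀` there. -/
theorem cantorFun_sub_ge (hk : 1 ≤ 3 ^ k₀ * ((α - 2) / 4)) (n : ℕ) {x y : ℝ}
    (hx : x ≤ 1 / 3) (hy : 2 / 3 + (α - 2) / 12 ≤ y) :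
    (1 / 2) ^ (n + 1 + k₀) ≤ cantorFun n y - cantorFun n x := by
  have hα : 0 ≤ α - 2 := by
    by_contra! h
    have : 3 ^ k₀ * ((α - 2) / 4) ≤ 0 :=
      mul_nonpos_of_nonneg_of_nonpos (by positivity) (by linarith)
    linarith
  have h1 := monotone_cantorFun n hx
  have h2 := monotone_cantorFun n hy
  have h3 : cantorFun n (1 / 3) = (1 / 2) ^ (n + 1) := by
    rw [cantorFun, cantorLim_left' isDyadicBound_half n le_rfl,
      cantorLim_of_one_le isDyadicBound_half _ (by norm_num)]
  have h4 : cantorFun n (2 / 3 + (α - 2) / 12) =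
      cantorFun (n + 1) ((α - 2) / 4) + ((1 / 2) ^ n - (1 / 2) ^ (n + 1)) := by
    rw [cantorFun, cantorLim_right' isDyadicBound_half n (by linarith)]
    congr 2
    ring
  have h5 := le_cantorFun (n + 1) hk
  have h6 : (1 / 2 : ℝ) ^ n = (1 / 2) ^ (n + 1) + (1 / 2) ^ (n + 1) := by ring
  linarith

/-- Zoom in while `x` and `y` lie in the same copy; the trivial bound at the last scale is the error
term, which vanishes as `k → ∞`. Zooming stops when `y` reaches the ramp to the right of `x`, where
the growth of the Cantor function already dominates the total oscillation. -/
theorem abs_cantorLim_sub_le_aux (h : IsDyadicBound T e) (hα : 2 < α)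
    (hn₀ : ∀ n ≥ n₀, α * (1 / (12 * ((n : ℝ) + 1))) ≤ (α - 2) / 12)
    (hk₀ : 1 ≤ 3 ^ k₀ * ((α - 2) / 4)) {K : ℝ} (k n : ℕ) (hn : n₀ ≤ n)
    (hK : 12 * e n * 2 ^ k₀ ≤ K) {x y : ℝ} (hx : x ∈ cantorSet) (hxy : x ≤ y) :
    |cantorLim T n y - cantorLim T n x| ≤
      K * (cantorFun n (x + α * (y - x)) - cantorFun n x) + 6 * (e n * (1 / 2) ^ (n + k)) := by
  have hK0 : 0 ≤ K := le_trans (mul_nonneg (mul_nonneg (by norm_num) (h.nonneg n))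
    (by positivity)) hK
  have hxz : x ≤ x + α * (y - x) := by nlinarith
  have hm : ∀ k, 0 ≤ 6 * (e n * (1 / 2) ^ (n + k)) := fun k ↦ mul_nonneg (by norm_num)
    (mul_nonneg (h.nonneg n) (by positivity))
  induction k generalizing n x y with
  | zero =>
    have := mul_nonneg hK0 (sub_nonneg.2 (monotone_cantorFun n hxz))
    have := abs_cantorLim_sub_le h n y x
    rw [add_zero]
    linarith
  | succ k ih =>
    have hK' : 12 * e (n + 1) * 2 ^ k₀ ≤ K := le_trans (by
      have := h.anti n.le_succ
      gcongr) hK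
    have hs := h.step n k
    have e1 : e n * (1 / 2) ^ (n + (k + 1)) = e n * (1 / 2) ^ (n + k) / 2 := by
      rw [← add_assoc, pow_succ]; ring
    have hm' : ∀ k, 0 ≤ 6 * (e (n + 1) * (1 / 2) ^ (n + 1 + k)) := fun k ↦
      mul_nonneg (by norm_num) (mul_nonneg (h.nonneg _) (by positivity))
    rcases cantorSet_cases hx with ⟨-, hx1, hx'⟩ | ⟨hx2, hx1, hx'⟩
    · rcases le_or_gt y (1 / 2 - 1 / (12 * (n + 1))) with hy | hy
      · have := ih (n + 1) (by omega) hK' (x := 3 * x) (y := 3 * y) hx' (by linarith)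
          (by nlinarith) hm'
        rw [cantorLim_left h n hy, cantorLim_left' h n hx1, cantorFun_eq n (x + α * (y - x)),
          cantorFun_eq n x, e1]
        have hm2 := monotone_cantorFun (n + 1)
          (show 3 * x - 2 ≤ 3 * (x + α * (y - x)) - 2 by linarith)
        rw [show 3 * x + α * (3 * y - 3 * x) = 3 * (x + α * (y - x)) by ring] at this
        nlinarith
      -- The minimum over `x ≤ 1/3` and `y ≥ 1/2 - w`, where `w` is the half-width of the ramp, is
      -- `2/3 + (α - 2)/6 - α w`; `hn₀` lets `α w` use up half of the excess.
      · have h1 : 2 / 3 + (α - 2) / 12 ≤ x + α * (y - x) := by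
          have := hn₀ n hn
          nlinarith
        have h2 := cantorFun_sub_ge hk₀ n hx1 h1
        have h3 := abs_cantorLim_sub_le h n y x
        have h4 : 6 * (e n * (1 / 2) ^ n) ≤ K * (1 / 2) ^ (n + 1 + k₀) := by
          refine le_trans (le_of_eq ?_) (mul_le_mul_of_nonneg_right hK (by positivity))
          rw [pow_add, pow_add, one_div, inv_pow 2 k₀]
          field_simp
          ring
        have h5 := mul_le_mul_of_nonneg_left h2 hK0
        linarith [hm (k + 1)]
    · have := ih (n + 1) (by omega) hK' (x := 3 * x - 2) (y := 3 * y - 2) hx' (by linarith)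
        (by nlinarith) hm'
      have hz : 2 / 3 ≤ x + α * (y - x) := by linarith
      rw [cantorLim_right' h n (show 2 / 3 ≤ y by linarith), cantorLim_right' h n hx2, e1,
        cantorFun, cantorLim_right' isDyadicBound_half n hz,
        cantorLim_right' isDyadicBound_half n hx2]
      rw [show 3 * x - 2 + α * (3 * y - 2 - (3 * x - 2)) = 3 * (x + α * (y - x)) - 2 by ring,
        cantorFun] at this
      rw [add_sub_add_right_eq_sub, add_sub_add_right_eq_sub]
      linarith

theorem abs_cantorLim_sub_le_cantorFun (h : IsDyadicBound T e) (hα : 2 < α)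
    (hn₀ : ∀ n ≥ n₀, α * (1 / (12 * ((n : ℝ) + 1))) ≤ (α - 2) / 12)
    (hk₀ : 1 ≤ 3 ^ k₀ * ((α - 2) / 4)) {K : ℝ} (n : ℕ) (hn : n₀ ≤ n)
    (hK : 12 * e n * 2 ^ k₀ ≤ K) {x y : ℝ} (hx : x ∈ cantorSet) (hxy : x ≤ y) :
    |cantorLim T n y - cantorLim T n x| ≤
      K * (cantorFun n (x + α * (y - x)) - cantorFun n x) := by
  have h0 : Tendsto (fun k : ℕ ↦ K * (cantorFun n (x + α * (y - x)) - cantorFun n x) +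
      6 * (e n * (1 / 2) ^ n) * (1 / 2 : ℝ) ^ k) atTop
      (𝓝 (K * (cantorFun n (x + α * (y - x)) - cantorFun n x) + 6 * (e n * (1 / 2) ^ n) * 0)) :=
    ((tendsto_pow_atTop_nhds_zero_of_lt_one (by norm_num) (by norm_num)).const_mul _).const_add _
  rw [mul_zero, add_zero] at h0
  refine ge_of_tendsto' h0 fun k ↦ ?_
  refine (abs_cantorLim_sub_le_aux h hα hn₀ hk₀ k n hn hK hx hxy).trans (le_of_eq ?_)
  ring

/-- For `y` close to `x` the first `N` zooms need no condition on the ramp width, so `K` only has to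
dominate `e (n + N)`, which can be made arbitrarily small. -/
theorem exists_abs_cantorLim_sub_le (h : IsDyadicBound T e) (hα : 2 < α)
    (hn₀ : ∀ n ≥ n₀, α * (1 / (12 * ((n : ℝ) + 1))) ≤ (α - 2) / 12)
    (hk₀ : 1 ≤ 3 ^ k₀ * ((α - 2) / 4)) {K : ℝ} (N n : ℕ) (hn : n₀ ≤ n + N)
    (hK : 12 * e (n + N) * 2 ^ k₀ ≤ K) {x : ℝ} (hx : x ∈ cantorSet) :
    ∃ δ > 0, ∀ y, x ≤ y → y < x + δ → |cantorLim T n y - cantorLim T n x| ≤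
      K * (cantorFun n (x + α * (y - x)) - cantorFun n x) := by
  have hK0 : 0 ≤ K := le_trans (mul_nonneg (mul_nonneg (by norm_num) (h.nonneg _))
    (by positivity)) hK
  induction N generalizing n x with
  | zero =>
    exact ⟨1, one_pos, fun y hy _ ↦ abs_cantorLim_sub_le_cantorFun h hα hn₀ hk₀ n hn hK hx hy⟩
  | succ N ih =>
    rw [show n + (N + 1) = n + 1 + N by ring] at hn hK
    rcases cantorSet_cases hx with ⟨-, hx1, hx'⟩ | ⟨hx2, hx1, hx'⟩
    · obtain ⟨δ, hδ, H⟩ := ih (n + 1) hn hK hx'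
      -- Staying within `1/12` of the left third keeps `y` below `5/12`, hence before the ramp.
      refine ⟨min (δ / 3) (1 / 12), by positivity, fun y hy hyδ ↦ ?_⟩
      have hy1 : y < x + δ / 3 := hyδ.trans_le (by gcongr; exact min_le_left _ _)
      have hy2 : y < x + 1 / 12 := hyδ.trans_le (by gcongr; exact min_le_right _ _)
      have := H (3 * y) (by linarith) (by linarith)
      have hxz : x ≤ x + α * (y - x) := by nlinarith
      rw [cantorLim_left h n (show y ≤ _ by linarith [ramp_halfwidth_le n]),
        cantorLim_left' h n hx1, cantorFun_eq n (x + α * (y - x)), cantorFun_eq n x]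
      have hm2 := monotone_cantorFun (n + 1)
        (show 3 * x - 2 ≤ 3 * (x + α * (y - x)) - 2 by linarith)
      rw [show 3 * x + α * (3 * y - 3 * x) = 3 * (x + α * (y - x)) by ring] at this
      nlinarith
    · obtain ⟨δ, hδ, H⟩ := ih (n + 1) hn hK hx'
      refine ⟨δ / 3, by positivity, fun y hy hyδ ↦ ?_⟩
      have := H (3 * y - 2) (by linarith) (by linarith)
      have hz : 2 / 3 ≤ x + α * (y - x) := by nlinarith
      rw [cantorLim_right' h n (show 2 / 3 ≤ y by linarith), cantorLim_right' h n hx2,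
        cantorFun, cantorLim_right' isDyadicBound_half n hz,
        cantorLim_right' isDyadicBound_half n hx2]
      rw [show 3 * x - 2 + α * (3 * y - 2 - (3 * x - 2)) = 3 * (x + α * (y - x)) - 2 by ring,
        cantorFun] at this
      rw [add_sub_add_right_eq_sub, add_sub_add_right_eq_sub]
      linarith

theorem eventually_abs_cantorLim_sub_le_right (h : IsDyadicBound T e)
    (he : Tendsto e atTop (𝓝 0)) (hα : 2 < α) {ε : ℝ} (hε : 0 < ε) (n : ℕ) {x : ℝ}
    (hx : x ∈ cantorSet) :
    ∃ δ > 0, ∀ y, x ≤ y → y < x + δ → |cantorLim T n y - cantorLim T n x| ≤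
      ε * (cantorFun n (x + α * (y - x)) - cantorFun n x) := by
  obtain ⟨k₀, hk₀⟩ := pow_unbounded_of_one_lt (4 / (α - 2)) (show (1 : ℝ) < 3 by norm_num)
  have hk₀' : 1 ≤ 3 ^ k₀ * ((α - 2) / 4) := by
    rw [div_lt_iff₀ (by linarith)] at hk₀
    linarith
  obtain ⟨n₀, hn₀⟩ := exists_nat_ge (α / (α - 2))
  have hn₀' : ∀ n ≥ n₀, α * (1 / (12 * ((n : ℝ) + 1))) ≤ (α - 2) / 12 := by
    intro m hm
    have hm' : (n₀ : ℝ) ≤ m := by exact_mod_cast hm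
    rw [div_le_iff₀ (by linarith)] at hn₀
    rw [mul_one_div, div_le_div_iff₀ (by positivity) (by norm_num)]
    nlinarith
  -- Here `k₀` depends only on `α`, so the admissible constant tends to `0` with `e`.
  have h1 : Tendsto (fun N ↦ 12 * e (n + N) * 2 ^ k₀) atTop (𝓝 (12 * 0 * 2 ^ k₀)) := by
    refine (Tendsto.const_mul _ ?_).mul_const _
    simpa [add_comm] using (tendsto_add_atTop_iff_nat n).2 he
  rw [mul_zero, zero_mul] at h1
  obtain ⟨N, hN1, hN2⟩ := ((h1.eventually_lt_const hε).and (eventually_ge_atTop n₀)).exists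
  exact exists_abs_cantorLim_sub_le h hα hn₀' hk₀' N n (by omega) hN1.le hx

theorem eventually_abs_cantorLim_sub_le (h : IsDyadicBound T e)
    (he : Tendsto e atTop (𝓝 0)) (hα : 2 < α) {ε : ℝ} (hε : 0 < ε) (n : ℕ) {x : ℝ}
    (hx : x ∈ cantorSet) :
    ∀ᶠ y in 𝓝 x, |cantorLim T n y - cantorLim T n x| ≤
      ε * |cantorFun n (x + α * (y - x)) - cantorFun n x| := by
  obtain ⟨δ, hδ, H⟩ := eventually_abs_cantorLim_sub_le_right h he hα hε n hx
  obtain ⟨δ', hδ', H'⟩ := eventually_abs_cantorLim_sub_le_right h he hα hε n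
    (one_sub_mem_cantorSet hx)
  filter_upwards [Ioo_mem_nhds (show x - δ' < x by linarith) (show x < x + δ by linarith)]
    with y hy
  rcases le_total x y with hxy | hxy
  · exact (H y hxy hy.2).trans (by gcongr; exact le_abs_self _)
  -- Left neighbourhoods follow from the symmetry `x ↦ 1 - x`.
  · have := H' (1 - y) (by linarith) (by linarith [hy.1])
    rw [show 1 - x + α * (1 - y - (1 - x)) = 1 - (x + α * (y - x)) by ring, cantorFun,
      cantorLim_one_sub h, cantorLim_one_sub h, cantorLim_one_sub isDyadicBound_half,
      cantorLim_one_sub isDyadicBound_half, sub_sub_sub_cancel_left, sub_sub_sub_cancel_left,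
      abs_sub_comm] at this
    refine this.trans ?_
    rw [abs_sub_comm]
    exact mul_le_mul_of_nonneg_left (le_abs_self _) hε.le

end

/-! ### Jump functions on countable sets. -/

/-- A monotone function which jumps on both sides of each point of a countable set. -/
theorem exists_monotone_jump {D : Set ℝ} (hD : D.Countable) :
    ∃ ψ : ℝ → ℝ, Monotone ψ ∧ ∀ x ∈ D, ∃ w > 0, ∀ y ≠ x, w ≤ |ψ y - ψ x| := by
  obtain ⟨d, hd⟩ := countable_iff_exists_subset_range.1 hD
  -- The strict and the weak indicator separate the value at `d i` from both sides.
  set g : ℕ → ℝ → ℝ := fun i x ↦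
    (1 / 2) ^ i * ((if d i < x then 1 else 0) + (if d i ≤ x then 1 else 0)) with hg
  have gm : ∀ i, Monotone (g i) := by
    intro i x y hxy
    refine mul_le_mul_of_nonneg_left (add_le_add ?_ ?_) (by positivity)
    · split_ifs with h1 h2 <;> linarith
    · split_ifs with h1 h2 <;> linarith
  have gs : ∀ x, Summable fun i ↦ g i x := by
    intro x
    refine Summable.of_nonneg_of_le (fun i ↦ ?_) (fun i ↦ ?_)
      (summable_geometric_two.mul_right (2 : ℝ))
    · rw [hg]; positivity
    · refine mul_le_mul_of_nonneg_left ?_ (by positivity)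
      split_ifs <;> norm_num
  have key : ∀ i x y, x ≤ y → g i y - g i x ≤ (∑' i, g i y) - ∑' i, g i x := by
    intro i x y hxy
    rw [← (gs y).tsum_sub (gs x)]
    exact ((gs y).sub (gs x)).le_tsum i fun j _ ↦ sub_nonneg.2 (gm j hxy)
  refine ⟨fun x ↦ ∑' i, g i x, fun x y hxy ↦ (gs x).tsum_le_tsum (fun i ↦ gm i hxy) (gs y), ?_⟩
  intro x hx
  obtain ⟨i, rfl⟩ := hd hx
  refine ⟨(1 / 2) ^ i, by positivity, fun y hy ↦ ?_⟩
  rcases lt_or_gt_of_ne hy with h | h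
  · have := key i y (d i) h.le
    rw [abs_sub_comm]
    refine le_trans ?_ (this.trans (le_abs_self _))
    simp [hg, h.not_ge, h.not_gt]
  · have := key i (d i) y h.le
    refine le_trans ?_ (this.trans (le_abs_self _))
    simp only [hg, h, h.le, lt_irrefl, le_refl, if_true, if_false]
    linarith

/-! ### The counterexample and its `MC_α` integrability. -/

/-- The increments of the function used as counterexample. -/
noncomputable def alternatingStep (n : ℕ) : ℝ := (-1 / 2) ^ n * (1 / (n + 1))

theorem isDyadicBound_alternatingStep :
    IsDyadicBound alternatingStep fun n : ℕ ↦ 1 / ((n : ℝ) + 1) where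
  anti := fun m n hmn ↦ one_div_le_one_div_of_le (by positivity) (by gcongr)
  bound := fun n ↦ by
    rw [alternatingStep, abs_mul, abs_pow, abs_of_pos (show (0 : ℝ) < 1 / (n + 1) by positivity),
      mul_comm]
    norm_num

/-- The indefinite integral of the counterexample. -/
noncomputable def oscillatingCantor : ℝ → ℝ := cantorLim alternatingStep 0

open Classical in
/-- The counterexample: the derivative of `oscillatingCantor` off the Cantor set. -/
noncomputable def oscillatingDeriv (x : ℝ) : ℝ :=
  if x ∈ cantorSet then 0 else deriv oscillatingCantor x

theorem isIndefiniteMCIntegral_oscillatingCantor {α : ℝ} (hα : 2 < α) :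
    IsIndefiniteMCIntegral α oscillatingCantor oscillatingDeriv univ := by
  obtain ⟨ψ, hψ, hD⟩ := exists_monotone_jump
    (countable_not_differentiableAt_cantorLim isDyadicBound_alternatingStep 0)
  have hstrict : StrictMono fun x ↦ x + cantorFun 0 x + ψ x := fun x y hxy ↦ by
    have := monotone_cantorFun 0 hxy.le
    have := hψ hxy.le
    dsimp only
    linarith
  -- Increments of monotone functions have the same sign and cannot cancel, so the sum dominates
  -- each summand.
  have hge : ∀ x y, |y - x| + |cantorFun 0 y - cantorFun 0 x| + |ψ y - ψ x| ≤
      |(y + cantorFun 0 y + ψ y) - (x + cantorFun 0 x + ψ x)| := by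
    intro x y
    rcases le_total x y with h | h
    · have h1 := monotone_cantorFun 0 h
      have h2 := hψ h
      rw [abs_of_nonneg (by linarith), abs_of_nonneg (by linarith), abs_of_nonneg (by linarith)]
      refine le_trans (le_of_eq ?_) (le_abs_self _)
      ring
    · have h1 := monotone_cantorFun 0 h
      have h2 := hψ h
      rw [abs_of_nonpos (by linarith), abs_of_nonpos (by linarith), abs_of_nonpos (by linarith)]
      refine le_trans (le_of_eq ?_) (neg_le_abs _)
      ring
  have h0 : ∀ {x y : ℝ}, y ≠ x → x + α * (y - x) ≠ x := fun {x y} hy h ↦ by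
    have : α * (y - x) = 0 := by linarith
    rcases mul_eq_zero.1 this with h | h
    · linarith
    · exact hy (by linarith)
  refine ⟨_, hstrict.strictMonoOn _, fun x _ ↦ ?_⟩
  rw [Metric.tendsto_nhds]
  intro ε hε
  suffices ∀ᶠ y in 𝓝[≠] x, |oscillatingCantor y - oscillatingCantor x
      - oscillatingDeriv x * (y - x)| ≤ ε / 2 * (|x + α * (y - x) - x| +
        |cantorFun 0 (x + α * (y - x)) - cantorFun 0 x| + |ψ (x + α * (y - x)) - ψ x|) by
    filter_upwards [this, self_mem_nhdsWithin] with y hy hyx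
    have hpos : 0 < |x + α * (y - x) - x| + |cantorFun 0 (x + α * (y - x)) - cantorFun 0 x| +
        |ψ (x + α * (y - x)) - ψ x| := by
      have := abs_pos.2 (sub_ne_zero.2 (h0 hyx))
      positivity
    have hle := hge x (x + α * (y - x))
    rw [dist_zero_right, Real.norm_eq_abs, abs_div, div_lt_iff₀ (hpos.trans_le hle)]
    nlinarith
  by_cases hx : x ∈ cantorSet
  · have := eventually_abs_cantorLim_sub_le isDyadicBound_alternatingStep
      tendsto_one_div_add_atTop_nhds_zero_nat hα (half_pos hε) 0 hx
    filter_upwards [this.filter_mono nhdsWithin_le_nhds] with y hy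
    rw [oscillatingDeriv, if_pos hx, zero_mul, sub_zero]
    refine hy.trans (mul_le_mul_of_nonneg_left ?_ (half_pos hε).le)
    linarith [abs_nonneg (x + α * (y - x) - x), abs_nonneg (ψ (x + α * (y - x)) - ψ x)]
  rw [oscillatingDeriv, if_neg hx]
  by_cases hd : DifferentiableAt ℝ oscillatingCantor x
  · have := (hasDerivAt_iff_isLittleO.1 hd.hasDerivAt).bound (half_pos hε)
    filter_upwards [this.filter_mono nhdsWithin_le_nhds] with y hy
    rw [Real.norm_eq_abs, Real.norm_eq_abs, smul_eq_mul] at hy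
    rw [mul_comm (deriv _ _)]
    refine hy.trans (mul_le_mul_of_nonneg_left ?_ (half_pos hε).le)
    rw [add_sub_cancel_left, abs_mul, abs_of_pos (by linarith : 0 < α)]
    nlinarith [abs_nonneg (y - x), abs_nonneg (ψ (x + α * (y - x)) - ψ x),
      abs_nonneg (cantorFun 0 (x + α * (y - x)) - cantorFun 0 x)]
  -- At a ramp corner the denominator stays at least `w`, so continuity of the numerator suffices,
  -- whatever value `deriv` takes there.
  · obtain ⟨w, hw, H⟩ := hD x ⟨hx, hd⟩
    have hc : Continuous oscillatingCantor := continuous_cantorLim isDyadicBound_alternatingStep 0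
    have : Tendsto (fun y ↦ |oscillatingCantor y - oscillatingCantor x
        - deriv oscillatingCantor x * (y - x)|) (𝓝 x) (𝓝 |oscillatingCantor x -
          oscillatingCantor x - deriv oscillatingCantor x * (x - x)|) :=
      Continuous.tendsto (by fun_prop) x
    rw [sub_self, sub_self, mul_zero, sub_zero, abs_zero] at this
    filter_upwards [(this.eventually_lt_const (show 0 < ε / 2 * w by positivity)).filter_mono
      nhdsWithin_le_nhds, self_mem_nhdsWithin] with y hy hyx
    refine hy.le.trans (mul_le_mul_of_nonneg_left ?_ (half_pos hε).le)
    linarith [H _ (h0 hyx), abs_nonneg (x + α * (y - x) - x),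
      abs_nonneg (cantorFun 0 (x + α * (y - x)) - cantorFun 0 x)]

/-! ### Absolute continuity and Lusin's condition (N). -/

theorem IsACOn.mono {F : ℝ → ℝ} {E E' : Set ℝ} (h : IsACOn F E) (hE : E' ⊆ E) : IsACOn F E' := by
  intro ε hε
  obtain ⟨δ, hδ, H⟩ := h ε hε
  exact ⟨δ, hδ, fun n a b ha hb ↦ H n a b (fun i ↦ hE (ha i)) fun i ↦ hE (hb i)⟩

theorem IsACOn.exists_finset {F : ℝ → ℝ} {E : Set ℝ} (h : IsACOn F E) {ε : ℝ} (hε : 0 < ε) :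
    ∃ δ > 0, ∀ {ι : Type} (s : Finset ι) (a b : ι → ℝ), (∀ i ∈ s, a i ∈ E) → (∀ i ∈ s, b i ∈ E) →
      (∀ i ∈ s, a i ≤ b i) → (s : Set ι).PairwiseDisjoint (fun i ↦ Ioo (a i) (b i)) →
      ∑ i ∈ s, (b i - a i) < δ → ∑ i ∈ s, |F (b i) - F (a i)| < ε := by
  obtain ⟨δ, hδ, H⟩ := h ε hε
  refine ⟨δ, hδ, fun {ι} s a b ha hb hab hd hs ↦ ?_⟩
  have e : ∀ g : ι → ℝ, ∑ i, g (s.equivFin.symm i : ι) = ∑ i ∈ s, g i := fun g ↦ by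
    rw [s.equivFin.symm.sum_comp (fun i : s ↦ g i), Finset.sum_coe_sort]
  rw [← e] at hs ⊢
  refine H _ (fun i ↦ a (s.equivFin.symm i)) (fun i ↦ b (s.equivFin.symm i))
    (fun i ↦ ha _ (s.equivFin.symm i).2) (fun i ↦ hb _ (s.equivFin.symm i).2)
    (fun i ↦ hab _ (s.equivFin.symm i).2) (fun i j hij ↦ ?_) hs
  refine hd (s.equivFin.symm i).2 (s.equivFin.symm j).2 fun h ↦ hij ?_
  exact s.equivFin.symm.injective (Subtype.ext h)

/-- The factor `2` is the price for a diameter that need not be attained. -/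
theorem exists_ediam_image_le {Q : ℝ → ℝ} {S : Set ℝ} (hS : S.Nonempty)
    (hd : Metric.ediam (Q '' S) ≠ ⊤) :
    ∃ a ∈ S, ∃ b ∈ S, a ≤ b ∧ Metric.ediam (Q '' S) ≤ 2 * ENNReal.ofReal |Q b - Q a| := by
  have key : ∃ x ∈ S, ∃ y ∈ S, Metric.ediam (Q '' S) ≤ 2 * ENNReal.ofReal |Q y - Q x| := by
    by_cases h0 : Metric.ediam (Q '' S) = 0
    · obtain ⟨x, hx⟩ := hS
      exact ⟨x, hx, x, hx, by simp [h0]⟩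
    · have h1 : ¬ Metric.ediam (Q '' S) ≤ Metric.ediam (Q '' S) / 2 :=
        not_le.2 (ENNReal.half_lt_self h0 hd)
      rw [Metric.ediam_le_iff] at h1
      push Not at h1
      obtain ⟨_, ⟨x, hx, rfl⟩, _, ⟨y, hy, rfl⟩, hxy⟩ := h1
      refine ⟨y, hy, x, hx, ?_⟩
      rw [edist_dist, Real.dist_eq] at hxy
      have := hxy.le
      rwa [ENNReal.div_le_iff_le_mul (by simp) (by simp), mul_comm] at this
  obtain ⟨x, hx, y, hy, h⟩ := key
  rcases le_total x y with hxy | hxy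
  · exact ⟨x, hx, y, hy, hxy, h⟩
  · exact ⟨y, hy, x, hx, hxy, by rwa [abs_sub_comm]⟩

/-- Lusin's condition (N) for absolutely continuous functions. -/
theorem IsACOn.volume_image_eq_zero {Q : ℝ → ℝ} {S Z : Set ℝ} (hQ : IsACOn Q S) (hZS : Z ⊆ S)
    (hZ : volume Z = 0) : volume (Q '' Z) = 0 := by
  have key : ∀ ε > 0, volume (Q '' Z) ≤ 2 * ENNReal.ofReal ε := by
    intro ε hε
    obtain ⟨δ, hδ, H⟩ := hQ.exists_finset hε
    obtain ⟨U, hZU, hU, hUδ⟩ := Z.exists_isOpen_lt_of_lt (μ := volume) (ENNReal.ofReal δ)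
      (by rw [hZ]; simpa using hδ)
    -- On each component of `U`, the diameter of the image is at most twice one increment of `Q`.
    -- The corresponding intervals are disjoint with total length below `δ`, so AC bounds the sum.
    set 𝒞 : Set (Set ℝ) := connectedComponentIn U '' Z with h𝒞
    have hopen : ∀ c ∈ 𝒞, IsOpen c := by
      rintro _ ⟨x, -, rfl⟩
      exact hU.connectedComponentIn
    have hsub : ∀ c ∈ 𝒞, c ⊆ U := by
      rintro _ ⟨x, -, rfl⟩
      exact connectedComponentIn_subset _ _
    have hconn : ∀ c ∈ 𝒞, IsPreconnected c := by
      rintro _ ⟨x, -, rfl⟩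
      exact isPreconnected_connectedComponentIn
    have hne : ∀ c ∈ 𝒞, (Z ∩ c).Nonempty := by
      rintro _ ⟨x, hx, rfl⟩
      exact ⟨x, hx, mem_connectedComponentIn (hZU hx)⟩
    have hdisj : 𝒞.PairwiseDisjoint id := by
      rintro _ ⟨x, hx, rfl⟩ _ ⟨y, hy, rfl⟩ hxy
      refine Set.disjoint_left.2 fun z hz1 hz2 ↦ hxy ?_
      rw [connectedComponentIn_eq hz1, connectedComponentIn_eq hz2]
    have hcount : 𝒞.Countable :=
      hdisj.countable_of_isOpen hopen fun c hc ↦ (hne c hc).mono inter_subset_right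
    have hfam : ∀ (s : Finset (Set ℝ)) (a b : Set ℝ → ℝ), (∀ c ∈ s, c ∈ 𝒞) →
        (∀ c ∈ s, a c ∈ Z ∩ c) → (∀ c ∈ s, b c ∈ Z ∩ c) → (∀ c ∈ s, a c ≤ b c) →
        ∑ c ∈ s, |Q (b c) - Q (a c)| < ε := by
      intro s a b hs ha hb hab
      have hI : ∀ c ∈ s, Ioo (a c) (b c) ⊆ c := fun c hc ↦
        Ioo_subset_Icc_self.trans ((hconn c (hs c hc)).Icc_subset (ha c hc).2 (hb c hc).2)
      have hd : (s : Set (Set ℝ)).PairwiseDisjoint fun c ↦ Ioo (a c) (b c) := by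
        intro c hc c' hc' hcc
        exact (hdisj (hs c hc) (hs c' hc') hcc).mono (hI c hc) (hI c' hc')
      refine H s a b (fun c hc ↦ hZS (ha c hc).1) (fun c hc ↦ hZS (hb c hc).1) hab hd ?_
      have h1 : ∑ c ∈ s, ENNReal.ofReal (b c - a c) ≤ volume U := by
        have := measure_biUnion_finset (μ := volume) hd fun c _ ↦ measurableSet_Ioo
        simp only [Real.volume_Ioo] at this
        rw [← this]
        exact measure_mono (iUnion₂_subset fun c hc ↦ (hI c hc).trans (hsub c (hs c hc)))
      rw [← ENNReal.ofReal_sum_of_nonneg fun c hc ↦ sub_nonneg.2 (hab c hc)] at h1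
      exact (ENNReal.ofReal_lt_ofReal_iff hδ).1 (h1.trans_lt hUδ)
    have hfin : ∀ c ∈ 𝒞, Metric.ediam (Q '' (Z ∩ c)) ≠ ⊤ := by
      intro c hc
      refine ne_top_of_le_ne_top (ENNReal.ofReal_ne_top (r := ε)) (Metric.ediam_le ?_)
      rintro _ ⟨x, hx, rfl⟩ _ ⟨y, hy, rfl⟩
      rw [edist_dist, Real.dist_eq]
      refine ENNReal.ofReal_le_ofReal ?_
      rcases le_total x y with hxy | hxy
      · have := hfam {c} (fun _ ↦ x) (fun _ ↦ y) (by simpa) (by simpa) (by simpa) (by simpa)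
        rw [Finset.sum_singleton, abs_sub_comm] at this
        exact this.le
      · have := hfam {c} (fun _ ↦ y) (fun _ ↦ x) (by simpa) (by simpa) (by simpa) (by simpa)
        rw [Finset.sum_singleton] at this
        exact this.le
    have hab : ∀ c : Set ℝ, ∃ p : ℝ × ℝ, c ∈ 𝒞 → p.1 ∈ Z ∩ c ∧ p.2 ∈ Z ∩ c ∧ p.1 ≤ p.2 ∧
        Metric.ediam (Q '' (Z ∩ c)) ≤ 2 * ENNReal.ofReal |Q p.2 - Q p.1| := by
      intro c
      by_cases hc : c ∈ 𝒞
      · obtain ⟨a, ha, b, hb, hab, h⟩ := exists_ediam_image_le (hne c hc) (hfin c hc)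
        exact ⟨(a, b), fun _ ↦ ⟨ha, hb, hab, h⟩⟩
      · exact ⟨0, fun h ↦ absurd h hc⟩
    choose p hp using hab
    have hcover : Q '' Z ⊆ ⋃ c ∈ 𝒞, Q '' (Z ∩ c) := by
      rintro _ ⟨x, hx, rfl⟩
      exact mem_iUnion₂.2 ⟨_, ⟨x, hx, rfl⟩, x, ⟨hx, mem_connectedComponentIn (hZU hx)⟩, rfl⟩
    refine (measure_mono hcover).trans ((measure_biUnion_le volume hcount _).trans ?_)
    refine ENNReal.summable.tsum_le_of_sum_le fun s ↦ ?_
    calc ∑ c ∈ s, volume (Q '' (Z ∩ c))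
        ≤ ∑ c ∈ s, 2 * ENNReal.ofReal |Q (p c).2 - Q (p c).1| :=
          Finset.sum_le_sum fun c _ ↦ (Real.volume_le_diam _).trans (hp c c.2).2.2.2
      _ = 2 * ENNReal.ofReal (∑ c ∈ s.map (Function.Embedding.subtype _),
            |Q (p c).2 - Q (p c).1|) := by
          rw [← Finset.mul_sum, ENNReal.ofReal_sum_of_nonneg fun _ _ ↦ abs_nonneg _,
            Finset.sum_map]
          rfl
      _ ≤ 2 * ENNReal.ofReal ε := by
          gcongr
          refine (hfam _ (fun c ↦ (p c).1) (fun c ↦ (p c).2) ?_ ?_ ?_ ?_).le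
          all_goals
            intro c hc
            obtain ⟨c, -, rfl⟩ := Finset.mem_map.1 hc
          · exact c.2
          · exact (hp c c.2).1
          · exact (hp c c.2).2.1
          · exact (hp c c.2).2.2.1
  have hlim : Tendsto (fun n : ℕ ↦ 2 * ENNReal.ofReal (1 / ((n : ℝ) + 1))) atTop
      (𝓝 (2 * ENNReal.ofReal 0)) :=
    ENNReal.Tendsto.const_mul
      (ENNReal.tendsto_ofReal tendsto_one_div_add_atTop_nhds_zero_nat) (Or.inr (by simp))
  rw [ENNReal.ofReal_zero, mul_zero] at hlim
  exact le_antisymm (ge_of_tendsto' hlim fun n ↦ key _ (by positivity)) bot_le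

/-! ### Functions with vanishing approximate derivative. -/

/-- The set of points `y` at which the slope of the chord of `Q` from `x` exceeds `η`. -/
def steepSet (Q : ℝ → ℝ) (η x : ℝ) : Set ℝ := {y | η * |y - x| < |Q y - Q x|}

/-- Density above `7/8` leaves at most `2l/8 = l/4` for the steep points. Any fraction making two
such sets too small to cover an interval of length `l` would do. -/
theorem HasApproxDerivAt.exists_volume_steepSet_le {Q : ℝ → ℝ} {x η : ℝ}
    (h : HasApproxDerivAt Q 0 x) (hη : 0 < η) :
    ∃ r > 0, ∀ l, 0 < l → l < r →
      volume (steepSet Q η x ∩ Icc (x - l) (x + l)) ≤ ENNReal.ofReal (l / 4) := by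
  obtain ⟨A, hA, hdens, hlim⟩ := h
  have h1 : ∀ᶠ y in 𝓝[A \ {x}] x, |Q y - Q x| ≤ η * |y - x| := by
    have := Metric.tendsto_nhds.1 hlim η hη
    filter_upwards [this, self_mem_nhdsWithin] with y hy hyA
    have hyx : 0 < |y - x| := abs_pos.2 (sub_ne_zero.2 hyA.2)
    rw [dist_zero_right, Real.norm_eq_abs, abs_div, div_lt_iff₀ hyx] at hy
    exact hy.le
  obtain ⟨r1, hr1, H1⟩ := Metric.mem_nhdsWithin_iff.1 h1
  have h2 : ∀ᶠ l in 𝓝[>] (0 : ℝ), ENNReal.ofReal (7 / 8) <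
      volume (A ∩ Icc (x - l) (x + l)) / ENNReal.ofReal (2 * l) :=
    hdens.eventually_const_lt (by
      rw [← ENNReal.ofReal_one]; exact (ENNReal.ofReal_lt_ofReal_iff one_pos).2 (by norm_num))
  obtain ⟨r2, hr2, H2⟩ := mem_nhdsGT_iff_exists_Ioo_subset.1 h2
  refine ⟨min r1 r2, lt_min hr1 hr2, fun l hl hlr ↦ ?_⟩
  have hsub : steepSet Q η x ∩ Icc (x - l) (x + l) ⊆ Icc (x - l) (x + l) \ A := by
    rintro y ⟨hy, hyl⟩
    refine ⟨hyl, fun hyA ↦ ?_⟩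
    rw [steepSet, mem_ofPred_eq] at hy
    by_cases hyx : y = x
    · simp [hyx] at hy
    · have : y ∈ Metric.ball x r1 := by
        rw [Metric.mem_ball, Real.dist_eq, abs_lt]
        constructor <;> linarith [hyl.1, hyl.2, min_le_left r1 r2]
      exact absurd (H1 ⟨this, hyA, hyx⟩) (not_le.2 hy)
  refine (measure_mono hsub).trans ?_
  have h3 := H2 ⟨hl, hlr.trans_le (min_le_right _ _)⟩
  rw [mem_ofPred_eq, ENNReal.lt_div_iff_mul_lt (Or.inl (by simpa using hl)) (Or.inl ENNReal.ofReal_ne_top),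
    ← ENNReal.ofReal_mul (by norm_num), inter_comm] at h3
  have h4 := measure_inter_add_sdiff (μ := volume) (Icc (x - l) (x + l)) hA
  rw [Real.volume_Icc, show x + l - (x - l) = 2 * l by ring] at h4
  have hf1 : volume (Icc (x - l) (x + l) ∩ A) ≠ ⊤ :=
    ne_top_of_le_ne_top (by simp) (measure_mono (inter_subset_left (t := A)))
  have hf2 : volume (Icc (x - l) (x + l) \ A) ≠ ⊤ :=
    ne_top_of_le_ne_top (by simp) (measure_mono (sdiff_subset (t := A)))
  have h5 := congrArg ENNReal.toReal h4
  rw [ENNReal.toReal_add hf1 hf2, ENNReal.toReal_ofReal (by linarith)] at h5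
  have h6 := ENNReal.ofReal_lt_iff_lt_toReal (by linarith) hf1 |>.1 h3
  rw [ENNReal.le_ofReal_iff_toReal_le hf2 (by linarith)]
  linarith

/-- Cut the line into cells of length `r`; `Q` is `K`-Lipschitz on `S` within each cell. -/
theorem volume_image_le_of_locally_lipschitz {Q : ℝ → ℝ} {S I : Set ℝ} {K : NNReal} {r : ℝ}
    (hr : 0 < r) (hI : MeasurableSet I) (hSI : S ⊆ I)
    (h : ∀ x ∈ S, ∀ y ∈ S, x < y → y < x + r → |Q x - Q y| ≤ K * (y - x)) :
    volume (Q '' S) ≤ K * volume I := by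
  set P : ℤ → Set ℝ := fun n ↦ Ico (n • r) ((n + 1) • r) with hP
  have hcov : S = ⋃ n, S ∩ P n := by
    rw [← inter_iUnion, hP, iUnion_Ico_zsmul hr, inter_univ]
  have hL : ∀ n, LipschitzOnWith K Q (S ∩ P n) := by
    intro n
    have hlt : ∀ x ∈ S ∩ P n, ∀ y ∈ S ∩ P n, y < x + r := by
      rintro x ⟨-, hx⟩ y ⟨-, hy⟩
      have h1 := hx.1
      have h2 := hy.2
      rw [add_smul, one_smul] at h2
      linarith
    refine LipschitzOnWith.of_dist_le_mul fun x hx y hy ↦ ?_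
    rw [Real.dist_eq, Real.dist_eq]
    rcases lt_trichotomy x y with hxy | hxy | hxy
    · rw [abs_sub_comm x y, abs_of_pos (sub_pos.2 hxy)]
      exact h x hx.1 y hy.1 hxy (hlt x hx y hy)
    · simp [hxy]
    · rw [abs_sub_comm, abs_of_pos (sub_pos.2 hxy)]
      exact h y hy.1 x hx.1 hxy (hlt y hy x hx)
  calc volume (Q '' S) = volume (⋃ n, Q '' (S ∩ P n)) := by rw [← image_iUnion, ← hcov]
    _ ≤ ∑' n, volume (Q '' (S ∩ P n)) := measure_iUnion_le _
    _ ≤ ∑' n, K * volume (I ∩ P n) := by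
        refine ENNReal.tsum_le_tsum fun n ↦ ?_
        have := (hL n).hausdorffMeasure_image_le zero_le_one
        rw [hausdorffMeasure_real, ENNReal.rpow_one] at this
        exact this.trans (by gcongr)
    _ = K * volume I := by
        rw [ENNReal.tsum_mul_left, ← measure_iUnion, ← inter_iUnion, hP, iUnion_Ico_zsmul hr,
          inter_univ]
        · exact fun i j hij ↦ (pairwise_disjoint_Ico_zsmul r hij).mono inter_subset_right
            inter_subset_right
        · exact fun n ↦ hI.inter measurableSet_Ico

theorem volume_image_eq_zero_of_hasApproxDerivAt_zero {Q : ℝ → ℝ} {S I : Set ℝ}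
    (hI : MeasurableSet I) (hI' : volume I ≠ ⊤) (hSI : S ⊆ I)
    (h : ∀ x ∈ S, HasApproxDerivAt Q 0 x) : volume (Q '' S) = 0 := by
  have key : ∀ η : NNReal, 0 < η → volume (Q '' S) ≤ η * volume I := by
    intro η hη
    set E : ℕ → Set ℝ := fun m ↦ {x | x ∈ S ∧ ∀ l, 0 < l → l < 1 / ((m : ℝ) + 1) →
      volume (steepSet Q η x ∩ Icc (x - l) (x + l)) ≤ ENNReal.ofReal (l / 4)} with hE
    have hmono : Monotone E := fun m n hmn x hx ↦ ⟨hx.1, fun l hl hlm ↦ hx.2 l hl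
      (hlm.trans_le (one_div_le_one_div_of_le (by positivity) (by gcongr)))⟩
    have hun : S = ⋃ m, E m := by
      refine subset_antisymm (fun x hx ↦ ?_) (iUnion_subset fun m x hx ↦ hx.1)
      obtain ⟨r, hr, H⟩ := (h x hx).exists_volume_steepSet_le (η := η) (by exact_mod_cast hη)
      obtain ⟨m, hm⟩ := exists_nat_one_div_lt hr
      exact mem_iUnion.2 ⟨m, hx, fun l hl hlm ↦ H l hl (hlm.trans hm)⟩
    have hm : Monotone fun m ↦ Q '' E m := fun m n hmn ↦ image_mono (hmono hmn)
    rw [hun, image_iUnion, hm.measure_iUnion]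
    refine iSup_le fun m ↦ volume_image_le_of_locally_lipschitz (r := 1 / ((m : ℝ) + 1))
      (by positivity) hI (fun x hx ↦ hSI hx.1) fun x hx y hy hxy hyr ↦ ?_
    have hl : 0 < y - x := sub_pos.2 hxy
    have h1 := hx.2 (y - x) hl (by linarith)
    have h2 := hy.2 (y - x) hl (by linarith)
    -- The two steep sets cover at most half of `[x, y]`; a point `z` outside both links `x` to `y`
    -- by two chords of slope at most `η`.
    obtain ⟨z, hz, hz1, hz2⟩ : ∃ z ∈ Icc x y, z ∉ steepSet Q η x ∧ z ∉ steepSet Q η y := by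
      by_contra! hc
      have hsub : Icc x y ⊆ (steepSet Q η x ∩ Icc (x - (y - x)) (x + (y - x))) ∪
          (steepSet Q η y ∩ Icc (y - (y - x)) (y + (y - x))) := by
        intro z hz
        by_cases hz1 : z ∈ steepSet Q η x
        · exact Or.inl ⟨hz1, by linarith [hz.1], by linarith [hz.2]⟩
        · exact Or.inr ⟨hc z hz hz1, by linarith [hz.1], by linarith [hz.2]⟩
      have := (measure_mono hsub).trans ((measure_union_le _ _).trans (add_le_add h1 h2))
      rw [Real.volume_Icc, ← ENNReal.ofReal_add (by linarith) (by linarith),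
        ENNReal.ofReal_le_ofReal_iff (by linarith)] at this
      linarith
    rw [steepSet, mem_ofPred_eq, not_lt] at hz1 hz2
    rw [abs_of_nonneg (by linarith [hz.1] : 0 ≤ z - x)] at hz1
    rw [abs_sub_comm z, abs_of_nonneg (by linarith [hz.2] : 0 ≤ y - z)] at hz2
    have := abs_sub_le (Q x) (Q z) (Q y)
    rw [abs_sub_comm (Q x) (Q z)] at this
    linarith
  have hlim : Tendsto (fun n : ℕ ↦ ENNReal.ofReal (1 / ((n : ℝ) + 1)) * volume I) atTop
      (𝓝 (ENNReal.ofReal 0 * volume I)) :=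
    ENNReal.Tendsto.mul_const
      (ENNReal.tendsto_ofReal tendsto_one_div_add_atTop_nhds_zero_nat) (Or.inr hI')
  rw [ENNReal.ofReal_zero, zero_mul] at hlim
  refine le_antisymm (ge_of_tendsto' hlim fun n ↦ ?_) bot_le
  exact key (1 / ((n : ℝ) + 1)).toNNReal (Real.toNNReal_pos.2 (by positivity))

/-- A continuous function, absolutely continuous on countably many sets which cover an interval,
is constant if its approximate derivative vanishes almost everywhere. -/
theorem eq_of_hasApproxDerivAt_zero {Q : ℝ → ℝ} {a b : ℝ} {S : ℕ → Set ℝ}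
    (hc : ContinuousOn Q (Ioo a b)) (hS : Ioo a b ⊆ ⋃ n, S n) (hQ : ∀ n, IsACOn Q (S n))
    (h : ∀ᵐ x : ℝ, x ∈ Ioo a b → HasApproxDerivAt Q 0 x) {x y : ℝ} (hx : x ∈ Ioo a b)
    (hy : y ∈ Ioo a b) : Q x = Q y := by
  set N : Set ℝ := {x | ¬ (x ∈ Ioo a b → HasApproxDerivAt Q 0 x)} with hN
  have hN0 : volume N = 0 := ae_iff.1 h
  have h1 : volume (Q '' (Ioo a b \ N)) = 0 := by
    refine volume_image_eq_zero_of_hasApproxDerivAt_zero (measurableSet_Ioo (a := a) (b := b))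
      (by simp) sdiff_subset fun x hx ↦ ?_
    by_contra hd
    exact hx.2 fun H ↦ hd (H hx.1)
  have h2 : ∀ n, volume (Q '' (N ∩ S n)) = 0 := fun n ↦
    (hQ n).volume_image_eq_zero inter_subset_right (measure_mono_null inter_subset_left hN0)
  have h3 : volume (Q '' Ioo a b) = 0 := by
    refine measure_mono_null (t := Q '' (Ioo a b \ N) ∪ ⋃ n, Q '' (N ∩ S n)) ?_
      (measure_union_null h1 (measure_iUnion_null h2))
    rintro _ ⟨x, hx, rfl⟩
    by_cases hxN : x ∈ N
    · obtain ⟨n, hn⟩ := mem_iUnion.1 (hS hx)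
      exact Or.inr (mem_iUnion.2 ⟨n, x, ⟨hxN, hn⟩, rfl⟩)
    · exact Or.inl ⟨x, ⟨hx, hxN⟩, rfl⟩
  -- A connected null subset of the line has at most one point.
  have hp : IsPreconnected (Q '' Ioo a b) := isPreconnected_Ioo.image Q hc
  have hle : ∀ {x y : ℝ}, x ∈ Ioo a b → y ∈ Ioo a b → Q y ≤ Q x := by
    intro x y hx hy
    have := measure_mono_null (hp.Icc_subset ⟨x, hx, rfl⟩ ⟨y, hy, rfl⟩) h3
    rw [Real.volume_Icc, ENNReal.ofReal_eq_zero] at this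
    linarith
  exact le_antisymm (hle hy hx) (hle hx hy)

/-! ### Comparison with a Denjoy–Khintchine integral on the gaps. -/

theorem IsACOn.sub_lipschitzOn {H F : ℝ → ℝ} {E : Set ℝ} {K : NNReal} (hH : IsACOn H E)
    (hF : LipschitzOnWith K F E) : IsACOn (fun x ↦ H x - F x) E := by
  intro ε hε
  obtain ⟨δ, hδ, h⟩ := hH (ε / 2) (half_pos hε)
  refine ⟨min δ (ε / (2 * (K + 1))), by positivity, fun n a b ha hb hab hd hs ↦ ?_⟩
  have h1 := h n a b ha hb hab hd (hs.trans_le (min_le_left _ _))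
  have h2 := (hs.trans_le (min_le_right _ _)).le
  rw [le_div_iff₀ (by positivity)] at h2
  have h0 : 0 ≤ ∑ i, (b i - a i) := Finset.sum_nonneg fun i _ ↦ sub_nonneg.2 (hab i)
  have h3 : ∑ i, |F (b i) - F (a i)| ≤ K * ∑ i, (b i - a i) := by
    rw [Finset.mul_sum]
    refine Finset.sum_le_sum fun i _ ↦ ?_
    have := hF.dist_le_mul _ (hb i) _ (ha i)
    rwa [Real.dist_eq, Real.dist_eq, abs_of_nonneg (sub_nonneg.2 (hab i))] at this
  calc ∑ i, |H (b i) - F (b i) - (H (a i) - F (a i))|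
      ≤ ∑ i, (|H (b i) - H (a i)| + |F (b i) - F (a i)|) := Finset.sum_le_sum fun i _ ↦ by
        rw [sub_sub_sub_comm]; exact abs_sub _ _
    _ = ∑ i, |H (b i) - H (a i)| + ∑ i, |F (b i) - F (a i)| := Finset.sum_add_distrib
    _ < ε := by nlinarith

theorem HasApproxDerivAt.sub_hasDerivAt {H F : ℝ → ℝ} {c d x : ℝ} (hH : HasApproxDerivAt H c x)
    (hF : HasDerivAt F d x) : HasApproxDerivAt (fun y ↦ H y - F y) (c - d) x := by
  obtain ⟨A, hA, hdens, hlim⟩ := hH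
  refine ⟨A, hA, hdens, ?_⟩
  have h1 := (hasDerivAt_iff_tendsto_slope.1 hF).mono_left
    (nhdsWithin_mono x (show A \ {x} ⊆ {x}ᶜ from fun y hy ↦ hy.2))
  refine (hlim.sub h1).congr fun y ↦ ?_
  rw [slope_def_field]
  ring

/-- The increments of `H` on the subintervals of `I` which do not meet the Cantor set are those of
`cantorLim alternatingStep n`. -/
def FollowsGapsOn (n : ℕ) (H : ℝ → ℝ) (I : Set ℝ) : Prop :=
  ∀ x ∈ I, ∀ y ∈ I, x < y → (∀ z ∈ Ioo x y, z ∉ cantorSet) →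
    H y - H x = cantorLim alternatingStep n y - cantorLim alternatingStep n x

/-- Near a gap point `oscillatingCantor` is Lipschitz, so subtracting it preserves the AC pieces and
leaves approximate derivative zero almost everywhere. -/
theorem IsIndefiniteDKIntegral.followsGapsOn {H : ℝ → ℝ}
    (hH : IsIndefiniteDKIntegral H oscillatingDeriv (Ioo 0 1)) : FollowsGapsOn 0 H (Ioo 0 1) := by
  obtain ⟨⟨hc, S, hS, hAC⟩, hd⟩ := hH
  intro x hx y hy hxy hgap
  have hF : Continuous oscillatingCantor := continuous_cantorLim isDyadicBound_alternatingStep 0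
  set Q : ℝ → ℝ := fun z ↦ H z - oscillatingCantor z with hQ
  have hQc : ContinuousOn Q (Ioo 0 1) := hc.sub hF.continuousOn
  have hsub : Icc x y ⊆ Ioo 0 1 := Icc_subset_Ioo hx.1 hy.2
  have hderiv : ∀ z ∈ Ioo x y, HasDerivAt Q 0 z := by
    intro z hz
    have hzC := hgap z hz
    rw [cantorSet, mem_iInter, not_forall] at hzC
    obtain ⟨k, hk⟩ := hzC
    obtain ⟨K, t, ht, hL⟩ := cantorLim_lipschitzOn_nhds isDyadicBound_alternatingStep k 0 hk
    obtain ⟨r, hr, hball⟩ := Metric.mem_nhds_iff.1 (inter_mem ht (Ioo_mem_nhds hz.1 hz.2))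
    rw [Real.ball_eq_Ioo] at hball
    have hIoo : Ioo (z - r) (z + r) ⊆ Ioo 0 1 := fun w hw ↦
      hsub (Ioo_subset_Icc_self (hball hw).2)
    have hzr : z ∈ Ioo (z - r) (z + r) := ⟨by linarith, by linarith⟩
    have hconst : ∀ w ∈ Ioo (z - r) (z + r), Q w = Q z := by
      intro w hw
      refine eq_of_hasApproxDerivAt_zero (S := fun n ↦ S n ∩ Ioo (z - r) (z + r))
        (hQc.mono hIoo) ?_ ?_ ?_ hw hzr
      · rw [← iUnion_inter, ← hS]
        exact fun w hw ↦ ⟨hIoo hw, hw⟩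
      · exact fun n ↦ ((hAC n).mono inter_subset_left).sub_lipschitzOn
          (hL.mono fun w hw ↦ (hball hw.2).1)
      · filter_upwards [hd, (countable_not_differentiableAt_cantorLim
          isDyadicBound_alternatingStep 0).ae_notMem volume] with w hw1 hw2 hw
        have hwC : w ∉ cantorSet := hgap w (hball hw).2
        have hdiff : DifferentiableAt ℝ oscillatingCantor w := by
          by_contra hn
          exact hw2 ⟨hwC, hn⟩
        have h1 := (hw1 (hIoo hw)).sub_hasDerivAt hdiff.hasDerivAt
        rwa [oscillatingDeriv, if_neg hwC, sub_self] at h1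
    refine (hasDerivAt_const z (Q z)).congr_of_eventuallyEq ?_
    filter_upwards [Ioo_mem_nhds hzr.1 hzr.2] with w hw using hconst w hw
  -- The endpoints may be Cantor points; the mean value theorem needs only continuity there.
  obtain ⟨z, hz, hzs⟩ := exists_deriv_eq_slope Q hxy (hQc.mono hsub)
    fun z hz ↦ (hderiv z hz).differentiableAt.differentiableWithinAt
  rw [(hderiv z hz).deriv, eq_comm, div_eq_zero_iff, or_iff_left (by linarith)] at hzs
  change H y - H x = oscillatingCantor y - oscillatingCantor x
  simp only [hQ] at hzs
  linarith

/-! ### Infinite variation on the Cantor set. -/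

/-- The alternating sign makes the two terms add up. With constant sign they would nearly cancel,
and the total variation over the gaps would be finite. -/
theorem alternatingStep_sub (n : ℕ) :
    (1 / 2) ^ n * (1 / ((n : ℝ) + 1)) ≤ |alternatingStep n - 2 * alternatingStep (n + 1)| := by
  have h : alternatingStep n - 2 * alternatingStep (n + 1) =
      (-1 / 2) ^ n * (1 / ((n : ℝ) + 1) + 1 / ((n : ℝ) + 1 + 1)) := by
    rw [alternatingStep, alternatingStep, pow_succ]
    push_cast
    ring
  rw [h, abs_mul, abs_pow, show |(-1 / 2 : ℝ)| = 1 / 2 by norm_num [abs_div],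
    abs_of_pos (show (0 : ℝ) < 1 / (n + 1) + 1 / (n + 1 + 1) by positivity)]
  have : (0 : ℝ) < 1 / (n + 1 + 1) := by positivity
  gcongr
  linarith

theorem cantorLim_alternatingStep_gap (n : ℕ) :
    cantorLim alternatingStep n (2 / 3) - cantorLim alternatingStep n (1 / 3) =
      alternatingStep n - 2 * alternatingStep (n + 1) := by
  rw [cantorLim_left' isDyadicBound_alternatingStep n le_rfl,
    cantorLim_right' isDyadicBound_alternatingStep n le_rfl,
    cantorLim_of_nonpos isDyadicBound_alternatingStep _ (by norm_num),
    cantorLim_of_one_le isDyadicBound_alternatingStep _ (by norm_num)]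
  ring

theorem div_three_mem_cantorSet_iff {t : ℝ} (ht : t ∈ Icc (0 : ℝ) 1) :
    t / 3 ∈ cantorSet ↔ t ∈ cantorSet := by
  refine ⟨fun h ↦ ?_, fun h ↦ mem_cantorSet_of_three_mul (by rwa [mul_div_cancel₀ _ (by norm_num)])⟩
  rcases cantorSet_cases h with ⟨-, -, h⟩ | ⟨h, -, -⟩
  · rwa [mul_div_cancel₀ _ (by norm_num)] at h
  · linarith [ht.2]

theorem two_add_div_three_mem_cantorSet_iff {t : ℝ} (ht : t ∈ Icc (0 : ℝ) 1) :
    (2 + t) / 3 ∈ cantorSet ↔ t ∈ cantorSet := by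
  have e : 3 * ((2 + t) / 3) - 2 = t := by ring
  refine ⟨fun h ↦ ?_, fun h ↦ mem_cantorSet_of_three_mul_sub (by rwa [e])⟩
  rcases cantorSet_cases h with ⟨-, h, -⟩ | ⟨-, -, h⟩
  · linarith [ht.1]
  · rwa [e] at h

/-- Intervals of order `m` of the construction of the Cantor set. -/
theorem exists_cantor_interval {T e : ℕ → ℝ} (h : IsDyadicBound T e) (m n : ℕ) {x : ℝ}
    (hx : x ∈ cantorSet) :
    ∃ p, 0 ≤ p ∧ p + (1 / 3) ^ m ≤ 1 ∧ p ≤ x ∧ x ≤ p + (1 / 3) ^ m ∧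
      (∀ t ∈ Icc (0 : ℝ) 1, p + (1 / 3) ^ m * t ∈ cantorSet ↔ t ∈ cantorSet) ∧
      ∃ c, ∀ t ∈ Icc (0 : ℝ) 1, cantorLim T n (p + (1 / 3) ^ m * t) = cantorLim T (n + m) t + c := by
  induction m generalizing n x with
  | zero =>
    have := cantorSet_subset_unitInterval hx
    exact ⟨0, le_rfl, by norm_num, this.1, by simpa using this.2, by simp, 0, by simp⟩
  | succ m ih =>
    have hq : ∀ {q t : ℝ}, 0 ≤ q → q + (1 / 3) ^ m ≤ 1 → t ∈ Icc (0 : ℝ) 1 →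
        q + (1 / 3) ^ m * t ∈ Icc (0 : ℝ) 1 := fun {q t} h0 h1 ht ↦ by
      have h3 : (0 : ℝ) ≤ (1 / 3) ^ m := by positivity
      constructor <;> nlinarith [ht.1, ht.2]
    rcases cantorSet_cases hx with ⟨-, hx1, hx'⟩ | ⟨hx2, hx1, hx'⟩
    · obtain ⟨q, h0, h1, hqx, hxq, hC, c, hc⟩ := ih (n + 1) hx'
      have e1 : ∀ t : ℝ, q / 3 + (1 / 3) ^ (m + 1) * t = (q + (1 / 3) ^ m * t) / 3 := fun t ↦ by
        ring
      have e2 : ((1 : ℝ) / 3) ^ (m + 1) = (1 / 3) ^ m / 3 := by ring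
      refine ⟨q / 3, by positivity, by linarith, by linarith, by linarith, fun t ht ↦ ?_, c,
        fun t ht ↦ ?_⟩
      · rw [e1, div_three_mem_cantorSet_iff (hq h0 h1 ht), hC t ht]
      · have := (hq h0 h1 ht).2
        rw [e1, cantorLim_left' h n (by linarith), mul_div_cancel₀ _ (by norm_num), hc t ht,
          show n + 1 + m = n + (m + 1) by ring]
    · obtain ⟨q, h0, h1, hqx, hxq, hC, c, hc⟩ := ih (n + 1) hx'
      have e1 : ∀ t : ℝ, (2 + q) / 3 + (1 / 3) ^ (m + 1) * t =
        (2 + (q + (1 / 3) ^ m * t)) / 3 := fun t ↦ by ring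
      have e2 : ((1 : ℝ) / 3) ^ (m + 1) = (1 / 3) ^ m / 3 := by ring
      refine ⟨(2 + q) / 3, by positivity, by linarith, by linarith, by linarith, fun t ht ↦ ?_,
        c + (T n - T (n + 1)), fun t ht ↦ ?_⟩
      · rw [e1, two_add_div_three_mem_cantorSet_iff (hq h0 h1 ht), hC t ht]
      · have := (hq h0 h1 ht).1
        rw [e1, cantorLim_right' h n (by linarith), mul_div_cancel₀ _ (by norm_num),
          add_sub_cancel_left, hc t ht, show n + 1 + m = n + (m + 1) by ring, add_assoc]

/-- Transfers the situation on an interval of order `m` to the whole of `[0, 1]`, shifting the level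
by `m`. -/
theorem FollowsGapsOn.comp {n m : ℕ} {H : ℝ → ℝ} {p c : ℝ}
    (hH : FollowsGapsOn n H (Icc p (p + (1 / 3) ^ m)))
    (hC : ∀ t ∈ Icc (0 : ℝ) 1, p + (1 / 3) ^ m * t ∈ cantorSet ↔ t ∈ cantorSet)
    (hc : ∀ t ∈ Icc (0 : ℝ) 1, cantorLim alternatingStep n (p + (1 / 3) ^ m * t) =
      cantorLim alternatingStep (n + m) t + c) :
    FollowsGapsOn (n + m) (fun t ↦ H (p + (1 / 3) ^ m * t)) (Icc 0 1) := by
  have h3 : (0 : ℝ) < (1 / 3) ^ m := by positivity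
  have hmem : ∀ t ∈ Icc (0 : ℝ) 1, p + (1 / 3) ^ m * t ∈ Icc p (p + (1 / 3) ^ m) := fun t ht ↦ by
    constructor <;> nlinarith [ht.1, ht.2]
  intro x hx y hy hxy hgap
  dsimp only
  rw [hH _ (hmem x hx) _ (hmem y hy) (by nlinarith) ?_, hc x hx, hc y hy]
  · ring
  · intro z hz hzC
    have ez : p + (1 / 3) ^ m * ((z - p) / (1 / 3) ^ m) = z := by
      rw [mul_div_cancel₀ _ h3.ne']; ring
    have h1 : x < (z - p) / (1 / 3) ^ m := by rw [lt_div_iff₀ h3]; linarith [hz.1]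
    have h2 : (z - p) / (1 / 3) ^ m < y := by rw [div_lt_iff₀ h3]; linarith [hz.2]
    refine hgap _ ⟨h1, h2⟩ ((hC _ ⟨hx.1.trans h1.le, h2.le.trans hy.2⟩).1 ?_)
    rwa [ez]

/-- The central gap contributes the first term of the harmonic sum; the two halves, each carrying
the weight `(1 / 2) ^ (n + 1)`, contribute the remaining ones. -/
theorem FollowsGapsOn.le_eVariationOn (k : ℕ) {n : ℕ} {H : ℝ → ℝ}
    (hH : FollowsGapsOn n H (Icc 0 1)) :
    ENNReal.ofReal ((1 / 2) ^ n * ∑ i ∈ Finset.range k, 1 / ((n : ℝ) + i + 1)) ≤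
      eVariationOn H cantorSet := by
  induction k generalizing n H with
  | zero => simp
  | succ k ih =>
    have hl := ih (n := n + 1) (H := H ∘ (· / 3)) ?_
    have hr := ih (n := n + 1) (H := H ∘ fun x ↦ (2 + x) / 3) ?_
    · have m1 : MonotoneOn (fun x : ℝ ↦ x / 3) cantorSet := fun x _ y _ hxy ↦ by
        dsimp only; linarith
      have m2 : MonotoneOn (fun x : ℝ ↦ (2 + x) / 3) cantorSet := fun x _ y _ hxy ↦ by
        dsimp only; linarith
      have hg : IsGreatest ((fun x : ℝ ↦ x / 3) '' cantorSet) (1 / 3) := by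
        refine ⟨⟨1, one_mem_cantorSet, rfl⟩, ?_⟩
        rintro _ ⟨x, hx, rfl⟩
        have := (cantorSet_subset_unitInterval hx).2
        dsimp only
        linarith
      have hL : IsLeast ((fun x : ℝ ↦ (2 + x) / 3) '' cantorSet) (2 / 3) := by
        refine ⟨⟨0, zero_mem_cantorSet, by norm_num⟩, ?_⟩
        rintro _ ⟨x, hx, rfl⟩
        have := (cantorSet_subset_unitInterval hx).1
        dsimp only
        linarith
      have hjump : ENNReal.ofReal ((1 / 2) ^ n * (1 / ((n : ℝ) + 1))) ≤
          edist (H (1 / 3)) (H (2 / 3)) := by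
        rw [edist_comm, edist_dist, Real.dist_eq, hH (1 / 3) (by norm_num) (2 / 3) (by norm_num)
          (by norm_num), cantorLim_alternatingStep_gap]
        · exact ENNReal.ofReal_le_ofReal (alternatingStep_sub n)
        · intro z hz hzC
          rcases cantorSet_cases hzC with ⟨-, h, -⟩ | ⟨h, -, -⟩
          · linarith [hz.1]
          · linarith [hz.2]
      rw [cantorSet_eq_union_halves, eVariationOn.union' H hg hL (by norm_num),
        ← eVariationOn.comp_eq_of_monotoneOn H _ m1, ← eVariationOn.comp_eq_of_monotoneOn H _ m2]
      refine le_trans (le_of_eq ?_) (add_le_add (add_le_add hl hjump) hr)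
      rw [← ENNReal.ofReal_add (by positivity) (by positivity),
        ← ENNReal.ofReal_add (by positivity) (by positivity), Finset.sum_range_succ']
      congr 1
      rw [show ∑ i ∈ Finset.range k, 1 / ((n : ℝ) + ((i + 1 : ℕ) : ℝ) + 1) =
        ∑ i ∈ Finset.range k, 1 / (((n + 1 : ℕ) : ℝ) + i + 1) from
          Finset.sum_congr rfl fun i _ ↦ by push_cast; ring]
      push_cast
      ring
    · intro x hx y hy hxy hgap
      have hx' : (2 + x) / 3 ∈ Icc (0 : ℝ) 1 := ⟨by linarith [hx.1], by linarith [hx.2]⟩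
      have hy' : (2 + y) / 3 ∈ Icc (0 : ℝ) 1 := ⟨by linarith [hy.1], by linarith [hy.2]⟩
      have := hH _ hx' _ hy' (by linarith) fun z hz hzC ↦ by
        refine hgap (3 * z - 2) ⟨by linarith [hz.1], by linarith [hz.2]⟩ ?_
        refine (two_add_div_three_mem_cantorSet_iff
          ⟨by linarith [hz.1, hx.1], by linarith [hz.2, hy.2]⟩).1 ?_
        rwa [show (2 + (3 * z - 2)) / 3 = z by ring]
      rw [cantorLim_right' isDyadicBound_alternatingStep n (by linarith [hy.1]),
        cantorLim_right' isDyadicBound_alternatingStep n (by linarith [hx.1]),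
        add_sub_add_right_eq_sub, mul_div_cancel₀ _ (by norm_num), mul_div_cancel₀ _ (by norm_num),
        add_sub_cancel_left, add_sub_cancel_left] at this
      exact this
    · intro x hx y hy hxy hgap
      have hx' : x / 3 ∈ Icc (0 : ℝ) 1 := ⟨by linarith [hx.1], by linarith [hx.2]⟩
      have hy' : y / 3 ∈ Icc (0 : ℝ) 1 := ⟨by linarith [hy.1], by linarith [hy.2]⟩
      have := hH _ hx' _ hy' (by linarith) fun z hz hzC ↦ by
        refine hgap (3 * z) ⟨by linarith [hz.1], by linarith [hz.2]⟩ ?_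
        refine (div_three_mem_cantorSet_iff
          ⟨by linarith [hz.1, hx.1], by linarith [hz.2, hy.2]⟩).1 ?_
        rwa [mul_div_cancel_left₀ _ (by norm_num)]
      rw [cantorLim_left' isDyadicBound_alternatingStep n (by linarith [hy.2]),
        cantorLim_left' isDyadicBound_alternatingStep n (by linarith [hx.2]),
        mul_div_cancel₀ _ (by norm_num), mul_div_cancel₀ _ (by norm_num)] at this
      exact this

theorem FollowsGapsOn.eVariationOn_eq_top {n : ℕ} {H : ℝ → ℝ}
    (hH : FollowsGapsOn n H (Icc 0 1)) : eVariationOn H cantorSet = ⊤ := by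
  have h1 : Tendsto (fun k : ℕ ↦ ∑ i ∈ Finset.range k, 1 / ((n : ℝ) + i + 1)) atTop atTop := by
    have h2 := tendsto_atTop_add_const_right atTop (-∑ i ∈ Finset.range n, 1 / ((i : ℝ) + 1))
      ((tendsto_add_atTop_iff_nat n).2 Real.tendsto_sum_range_one_div_nat_succ_atTop)
    refine h2.congr fun k ↦ ?_
    rw [add_comm k n, Finset.sum_range_add]
    push_cast
    ring
  have h2 := ENNReal.tendsto_ofReal_atTop.comp (h1.const_mul_atTop (show (0 : ℝ) < (1 / 2) ^ n by
    positivity))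
  exact top_le_iff.1 (le_of_tendsto' h2 fun k ↦ hH.le_eVariationOn k)

/-! ### Baire category argument and conclusion. -/

/-- The variation on a set is not increased by adding limit points at which the function is
continuous. -/
theorem eVariationOn_le_of_subset_closure {H : ℝ → ℝ} {S T : Set ℝ} (hT : T ⊆ closure S)
    (hc : ∀ x ∈ T, ContinuousAt H x) : eVariationOn H T ≤ eVariationOn H S := by
  -- The approximating sequence depends only on the point, so repeated partition points remain equal
  -- and monotonicity survives.
  have hr : ∀ x : ℝ, ∃ r : ℕ → ℝ, x ∈ T → (∀ k, r k ∈ S) ∧ Tendsto r atTop (𝓝 x) := by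
    intro x
    by_cases hx : x ∈ T
    · obtain ⟨r, hr⟩ := mem_closure_iff_seq_limit.1 (hT hx)
      exact ⟨r, fun _ ↦ hr⟩
    · exact ⟨0, fun h ↦ absurd h hx⟩
  choose r hr using hr
  refine iSup_le fun ⟨n, u, hu, us⟩ ↦ ?_
  have hmono : ∀ᶠ k in atTop, MonotoneOn (fun i ↦ r (u i) k) (Iic n) := by
    have : ∀ i ∈ Iic n, ∀ j ∈ Iic n, ∀ᶠ k in atTop, i ≤ j → r (u i) k ≤ r (u j) k := by
      intro i _ j _
      by_cases hij : i ≤ j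
      · rcases (hu hij).eq_or_lt with he | hlt
        · exact Eventually.of_forall fun k _ ↦ by rw [he]
        · filter_upwards [(hr _ (us i)).2.eventually_lt (hr _ (us j)).2 hlt] with k hk _
            using hk.le
      · exact Eventually.of_forall fun k h ↦ absurd h hij
    have h2 := (eventually_all_finite (finite_Iic n)).2 fun i hi ↦
      (eventually_all_finite (finite_Iic n)).2 (this i hi)
    filter_upwards [h2] with k hk i hi j hj hij using hk i hi j hj hij
  have hlim : Tendsto (fun k ↦ ∑ i ∈ Finset.range n, edist (H (r (u (i + 1)) k)) (H (r (u i) k)))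
      atTop (𝓝 (∑ i ∈ Finset.range n, edist (H (u (i + 1))) (H (u i)))) :=
    tendsto_finsetSum _ fun i _ ↦
      ((hc _ (us (i + 1))).tendsto.comp (hr _ (us (i + 1))).2).edist
        ((hc _ (us i)).tendsto.comp (hr _ (us i)).2)
  refine le_of_tendsto hlim ?_
  filter_upwards [hmono] with k hk
  exact eVariationOn.sum_le_of_monotoneOn_Iic hk fun i _ ↦ (hr _ (us i)).1 k

/-- Consecutive points of a monotone sequence in `[u, v]` bound non-overlapping intervals of total
length at most `v - u`. -/
theorem IsACOn.exists_eVariationOn_le {H : ℝ → ℝ} {S : Set ℝ} (h : IsACOn H S) :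
    ∃ δ > 0, ∀ u v, v - u < δ → eVariationOn H (S ∩ Icc u v) ≤ 1 := by
  obtain ⟨δ, hδ, hS⟩ := h.exists_finset one_pos
  refine ⟨δ, hδ, fun u v huv ↦ iSup_le fun ⟨n, w, hw, ws⟩ ↦ ?_⟩
  have h1 := hS (Finset.range n) w (fun i ↦ w (i + 1)) (fun i _ ↦ (ws i).1)
    (fun i _ ↦ (ws (i + 1)).1) (fun i _ ↦ hw i.le_succ) ?_ ?_
  · simp only [edist_dist, Real.dist_eq]
    rw [← ENNReal.ofReal_sum_of_nonneg fun _ _ ↦ abs_nonneg _, ← ENNReal.ofReal_one]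
    exact ENNReal.ofReal_le_ofReal h1.le
  · exact hw.pairwise_disjoint_on_Ioo_succ.set_pairwise _
  · rw [Finset.sum_range_sub w]
    linarith [(ws n).2.2, (ws 0).2.1]

theorem IsACOn.comp_affine {H : ℝ → ℝ} {S : Set ℝ} (h : IsACOn H S) (p : ℝ) {r : ℝ} (hr : 0 < r) :
    IsACOn (fun t ↦ H (p + r * t)) ((fun t ↦ p + r * t) ⁻¹' S) := by
  intro ε hε
  obtain ⟨δ, hδ, hS⟩ := h ε hε
  refine ⟨δ / r, by positivity, fun n a b ha hb hab hd hs ↦ ?_⟩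
  refine hS n (fun i ↦ p + r * a i) (fun i ↦ p + r * b i) ha hb
    (fun i ↦ by have := mul_le_mul_of_nonneg_left (hab i) hr.le; linarith) (fun i j hij ↦ ?_) ?_
  · refine Set.disjoint_left.2 fun z hz1 hz2 ↦ ?_
    have key : ∀ {i}, z ∈ Ioo (p + r * a i) (p + r * b i) → (z - p) / r ∈ Ioo (a i) (b i) :=
      fun {i} hz ↦ ⟨by rw [lt_div_iff₀ hr]; linarith [hz.1],
        by rw [div_lt_iff₀ hr]; linarith [hz.2]⟩
    exact Set.disjoint_left.1 (hd i j hij) (key hz1) (key hz2)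
  · rw [lt_div_iff₀ hr, mul_comm, Finset.mul_sum] at hs
    refine lt_of_le_of_lt (le_of_eq (Finset.sum_congr rfl fun i _ ↦ ?_)) hs
    ring

/-- A function with the increments of `cantorLim alternatingStep n` on the gaps of the Cantor set
is not generalized absolutely continuous. -/
theorem FollowsGapsOn.false_of_isACOn {n : ℕ} {H : ℝ → ℝ} (hH : FollowsGapsOn n H (Icc 0 1))
    (hc : ∀ t ∈ Icc (0 : ℝ) 1, ContinuousAt H t) {S : ℕ → Set ℝ} (hS : cantorSet ⊆ ⋃ i, S i)
    (hAC : ∀ i, IsACOn H (S i)) : False := by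
  have : Nonempty cantorSet := ⟨⟨0, zero_mem_cantorSet⟩⟩
  have : CompactSpace cantorSet := isCompact_iff_compactSpace.1 isCompact_cantorSet
  -- Baire in the compact space `cantorSet`: the closure of some `S i` contains a portion.
  obtain ⟨i, ⟨x, hx⟩, hxi⟩ := nonempty_interior_of_iUnion_of_closed
    (f := fun i ↦ ((↑) : cantorSet → ℝ) ⁻¹' closure (S i))
    (fun i ↦ isClosed_closure.preimage continuous_subtype_val) (by
      refine eq_univ_of_forall fun x ↦ ?_
      obtain ⟨i, hi⟩ := mem_iUnion.1 (hS x.2)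
      exact mem_iUnion.2 ⟨i, subset_closure hi⟩)
  obtain ⟨r, hr, hball⟩ := Metric.mem_nhds_iff.1 (mem_interior_iff_mem_nhds.1 hxi)
  obtain ⟨δ, hδ, hV⟩ := (hAC i).exists_eVariationOn_le
  -- The interval must fit in the ball of radius `r`, and its threefold enlargement must be shorter
  -- than `δ`.
  obtain ⟨m, hm⟩ := exists_pow_lt_of_lt_one (show 0 < min r (δ / 3) by positivity)
    (show (1 / 3 : ℝ) < 1 by norm_num)
  obtain ⟨p, hp0, hp1, hpx, hxp, hC, c, hcc⟩ :=
    exists_cantor_interval isDyadicBound_alternatingStep m n hx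
  have hmr := hm.trans_le (min_le_left _ _)
  have hmδ := hm.trans_le (min_le_right _ _)
  set q : ℝ := (1 / 3) ^ m with hq
  have hq0 : 0 < q := by positivity
  have htop := (FollowsGapsOn.comp (fun x hx y hy ↦ hH x ⟨hp0.trans hx.1, hx.2.trans hp1⟩ y
    ⟨hp0.trans hy.1, hy.2.trans hp1⟩) hC hcc).eVariationOn_eq_top
  have h1 : eVariationOn (H ∘ fun t ↦ p + q * t) cantorSet ≤
      eVariationOn H (cantorSet ∩ Icc p (p + q)) := by
    refine eVariationOn.comp_le_of_monotoneOn H _ (fun s _ t _ hst ↦ ?_) fun t ht ↦ ?_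
    · have := mul_le_mul_of_nonneg_left hst hq0.le
      linarith
    · have ht' := cantorSet_subset_unitInterval ht
      refine ⟨(hC t ht').2 ht, ?_, ?_⟩
      · have := mul_nonneg hq0.le ht'.1
        linarith
      · have := mul_le_mul_of_nonneg_left ht'.2 hq0.le
        linarith
  -- The window is enlarged by `q` on both sides because points of `S i` approximating an endpoint
  -- of `[p, p + q]` may lie outside it.
  have h2 : eVariationOn H (cantorSet ∩ Icc p (p + q)) ≤
      eVariationOn H (S i ∩ Icc (p - q) (p + 2 * q)) := by
    refine eVariationOn_le_of_subset_closure ?_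
      fun t ht ↦ hc t (cantorSet_subset_unitInterval ht.1)
    rintro t ⟨htC, ht⟩
    have h3 : t ∈ closure (S i) := by
      have h5 : (⟨t, htC⟩ : cantorSet) ∈ Metric.ball ⟨x, hx⟩ r := by
        rw [Metric.mem_ball, Subtype.dist_eq, Real.dist_eq, abs_lt]
        constructor <;> linarith [ht.1, ht.2]
      exact hball h5
    have h4 : t ∈ closure (Ioo (p - q) (p + 2 * q) ∩ S i) := isOpen_Ioo.inter_closure
      ⟨⟨by linarith [ht.1], by linarith [ht.2]⟩, h3⟩
    have h5 : Ioo (p - q) (p + 2 * q) ∩ S i ⊆ S i ∩ Icc (p - q) (p + 2 * q) :=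
      fun z hz ↦ ⟨hz.2, Ioo_subset_Icc_self hz.1⟩
    exact closure_mono h5 h4
  have h3 := h1.trans (h2.trans (hV (p - q) (p + 2 * q) (by linarith)))
  rw [show (H ∘ fun t ↦ p + q * t) = fun t ↦ H (p + q * t) from rfl, htop] at h3
  exact absurd h3 (by simp)

theorem not_dkIntegrableOn_Ioo : ¬ DKIntegrableOn oscillatingDeriv (Ioo 0 1) := by
  rintro ⟨H, hH⟩
  have hgap := hH.followsGapsOn
  obtain ⟨⟨hc, S, hS, hAC⟩, -⟩ := hH
  -- Continuity is known only on the open interval, so the argument is run on the order-2 interval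
  -- around `1/4`, whose length `1/9` keeps it away from `0` and `1`.
  obtain ⟨p, -, -, hpx, hxp, hC, c, hcc⟩ :=
    exists_cantor_interval isDyadicBound_alternatingStep 2 0 quarter_mem_cantorSet
  norm_num at hxp
  have hmem : ∀ t ∈ Icc (0 : ℝ) 1, p + (1 / 3) ^ 2 * t ∈ Ioo (0 : ℝ) 1 := fun t ht ↦
    ⟨by linarith [ht.1], by linarith [ht.2]⟩
  refine FollowsGapsOn.false_of_isACOn (FollowsGapsOn.comp (fun x hx y hy ↦ hgap x ?_ y ?_) hC hcc)
    (fun t ht ↦ ?_) (S := fun i ↦ (fun t ↦ p + (1 / 3) ^ 2 * t) ⁻¹' S i) ?_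
    fun i ↦ (hAC i).comp_affine p (by positivity)
  · exact ⟨by linarith [hx.1], by linarith [hx.2]⟩
  · exact ⟨by linarith [hy.1], by linarith [hy.2]⟩
  · exact ContinuousAt.comp (g := H) (f := fun t ↦ p + (1 / 3) ^ 2 * t)
      (hc.continuousAt (isOpen_Ioo.mem_nhds (hmem t ht))) (by fun_prop)
  · rw [← preimage_iUnion, ← hS]
    exact fun t ht ↦ hmem t (cantorSet_subset_unitInterval ht)

theorem DKIntegrableOn.mono {f : ℝ → ℝ} {I J : Set ℝ} (h : DKIntegrableOn f J) (hIJ : I ⊆ J) :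
    DKIntegrableOn f I := by
  obtain ⟨F, ⟨hc, S, hS, hAC⟩, hd⟩ := h
  refine ⟨F, ⟨hc.mono hIJ, fun n ↦ S n ∩ I, ?_, fun n ↦ (hAC n).mono inter_subset_left⟩, ?_⟩
  · rw [← iUnion_inter, ← hS, inter_eq_right.2 hIJ]
  · filter_upwards [hd] with x hx hxI using hx (hIJ hxI)

theorem mainTheorem3 :
    ∃ f : ℝ → ℝ,
      (∀ α : ℝ, 2 < α → MCIntegrableOn α f univ) ∧
      ¬ DKIntegrableOn f (Icc 0 1) ∧
      ¬ DKIntegrableOn f (Ioo 0 1) :=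
  ⟨oscillatingDeriv,
    fun _ hα ↦ ⟨oscillatingCantor, isIndefiniteMCIntegral_oscillatingCantor hα⟩,
    fun h ↦ not_dkIntegrableOn_Ioo (h.mono Ioo_subset_Icc_self), not_dkIntegrableOn_Ioo⟩
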